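/- Let $\alpha,b,\kappa\in\mathbb R$ and consider on the line the two-component $b$-system $$m_t=\alpha u_x-b\,u_x m-u\,m_x-\kappa\rho\rho_x,\quad m=u-u_{xx},\qquad \rho_t=-u\rho_x-(b-1)u_x\rho. \tag{1.3}$$ A weight $v:\mathbb R\to[0,\infty)$ is sub-multiplicative if $v(x+y)\le v(x)v(y)$ for all $x,y$. A positive function $\phi$ is $v$-moderate if there is $C_0>0$ with $\phi(x+y)\le C_0\,v(x)\phi(y)$ for all $x,y$. A function $\phi:\mathbb R\to(0,\infty)$ is an admissible weight if it is locally absolutely continuous, satisfies $|\phi'(x)|\le A|\phi(x)|$ for some $A>0$ and almost every $x$, and is $v$-moderate for some sub-multiplicative weight $v$ with $\inf_{\mathbb R}v>0$ and $\int_{\mathbb R}v(x)e^{-|x|}\,dx<\infty$. **Theorem 4.1.** Let $\phi$ be an admissible weight. There is a constant $C>0$, depending only on $\phi$ (and on the parameters $\alpha,b,\kappa$ of the system), such that the following holds. Let $1\le p\le\infty$, $s>3/2$, $T>0$, let $(u_0,\rho_0)\in H^s(\mathbb R)\times H^{s-1}(\mathbb R)$ satisfy $u_0\phi,\ u_{0,x}\phi,\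 \rho_0\phi\in L^p(\mathbb R)$, and let $(u,\rho)\in C([0,T];H^s(\mathbb R))\times C([0,T];H^{s-1}(\mathbb R))$ be a solution of (1.3) on $[0,T]$ (so $T$ may be any time below the maximal existence time), in the sense of distributions, with initial data $(u_0,\rho_0)$. Then $$M:=\sup_{t\in[0,T]}\bigl(\|u(t)\|_{L^\infty}+\|u_x(t)\|_{L^\infty}+\|\rho(t)\|_{L^\infty}\bigr)<\infty,$$ and for all $t\in[0,T]$ $$\|u(t)\phi\|_{L^p}+\|u_x(t)\phi\|_{L^p}+\|\rho(t)\phi\|_{L^p}\le\bigl(\|u_0\phi\|_{L^p}+\|u_{0,x}\phi\|_{L^p}+\|\rho_0\phi\|_{L^p}\bigr)\exp\{C(1+M)t\}.$$ -/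

import Mathlib

open MeasureTheory Set
open scoped ENNReal ContDiff SchwartzMap

namespace BSystem

/-- Test functions on the line: smooth with compact support. -/
def IsTest (ψ : ℝ → ℝ) : Prop :=
  ContDiff ℝ ∞ ψ ∧ HasCompactSupport ψ

/-- `g` is the weak (distributional) derivative of `f` on the line. -/
def HasWeakDeriv (f g : ℝ → ℝ) : Prop :=
  LocallyIntegrable f volume ∧ LocallyIntegrable g volume ∧
    ∀ ψ : ℝ → ℝ, IsTest ψ → ∫ x, f x * deriv ψ x = -∫ x, g x * ψ x

/-- The `L²` function `w` is the Bessel potential of order `s` of the real function `f ∈ L²`,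
i.e. `(1 + ξ²)^{s/2} f̂(ξ) = ŵ(ξ)`. Hence `f ∈ H^s`, with `‖f‖_{H^s} = ‖w‖_{L²}`. -/
def HasBesselPotential (s : ℝ) (f : ℝ → ℝ) (w : Lp ℂ 2 (volume : Measure ℝ)) : Prop :=
  ∃ hf : MemLp (fun x => (f x : ℂ)) 2 (volume : Measure ℝ),
    TemperedDistribution.besselPotential ℝ ℂ s ((hf.toLp _ : Lp ℂ 2 (volume : Measure ℝ)) : 𝓢'(ℝ, ℂ))
      = (w : 𝓢'(ℝ, ℂ))

/-- The real function `f` belongs to `H^s(ℝ)`; used for `s ≥ 0`, where `H^s ⊆ L²`. -/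
def MemHs (s : ℝ) (f : ℝ → ℝ) : Prop :=
  ∃ hf : MemLp (fun x => (f x : ℂ)) 2 (volume : Measure ℝ),
    TemperedDistribution.MemSobolev s 2
      ((hf.toLp _ : Lp ℂ 2 (volume : Measure ℝ)) : 𝓢'(ℝ, ℂ))

/-- `f ∈ C([0,T]; H^s(ℝ))`; used for `s ≥ 0`. Continuity in the `H^s` norm is continuity in `L²`
of the Bessel potentials of order `s`. -/
def IsContinuousInHs (s T : ℝ) (f : ℝ → ℝ → ℝ) : Prop :=
  ∃ w : ℝ → Lp ℂ 2 (volume : Measure ℝ), ContinuousOn w (Icc 0 T) ∧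
    ∀ t ∈ Icc (0 : ℝ) T, HasBesselPotential s (f t) (w t)

/-! Below `u, ux, ρ` are functions of `x`, with `ux` the weak derivative of `u`, and
`m = u - u_xx`. The products in the system are distributions, obtained from the product rule:
`u_x u_xx = (u_x²)_x / 2`, `u u_xx = (u u_x)_x - u_x²`, `u m_x = (u m)_x - u_x m`,
`ρ ρ_x = (ρ²)_x / 2`, `u ρ_x = (u ρ)_x - u_x ρ`. -/

/-- `⟨m, ψ⟩` for `m = u - u_xx`. -/
noncomputable def pairM (u ψ : ℝ → ℝ) : ℝ :=
  ∫ x, u x * (ψ x - iteratedDeriv 2 ψ x)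

/-- `⟨u_x m, ψ⟩` for `u_x m = u u_x - (u_x²)_x / 2`. -/
noncomputable def pairUxM (u ux ψ : ℝ → ℝ) : ℝ :=
  (∫ x, u x * ux x * ψ x) + (1 / 2) * ∫ x, ux x ^ 2 * deriv ψ x

/-- `⟨u m, ψ⟩` for `u m = u² - (u u_x)_x + u_x²`. -/
noncomputable def pairUM (u ux ψ : ℝ → ℝ) : ℝ :=
  (∫ x, (u x ^ 2 + ux x ^ 2) * ψ x) + ∫ x, u x * ux x * deriv ψ x

/-- `⟨u m_x, ψ⟩` for `u m_x = (u m)_x - u_x m`. -/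
noncomputable def pairUMx (u ux ψ : ℝ → ℝ) : ℝ :=
  -pairUM u ux (deriv ψ) - pairUxM u ux ψ

/-- `⟨ρ ρ_x, ψ⟩` for `ρ ρ_x = (ρ²)_x / 2`. -/
noncomputable def pairRhoRhox (ρ ψ : ℝ → ℝ) : ℝ :=
  -((1 / 2) * ∫ x, ρ x ^ 2 * deriv ψ x)

/-- `⟨u ρ_x, ψ⟩` for `u ρ_x = (u ρ)_x - u_x ρ`. -/
noncomputable def pairURhox (u ux ρ ψ : ℝ → ℝ) : ℝ :=
  -(∫ x, u x * ρ x * deriv ψ x) - ∫ x, ux x * ρ x * ψ x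

/-- `(u, ρ) ∈ C([0,T]; H^s) × C([0,T]; H^{s-1})` solves on `[0,T]` the two-component `b`-system
`m_t = α u_x - b u_x m - u m_x - κ ρ ρ_x`, `m = u - u_xx`, `ρ_t = -u ρ_x - (b-1) u_x ρ`
with initial data `(u₀, ρ₀)`; `ux t` is the weak derivative of `u t`. The equations hold in the
sense of distributions in `x` at every time of `[0,T]`. -/
structure IsSolution (α b κ s T : ℝ) (u₀ ρ₀ : ℝ → ℝ) (u ux ρ : ℝ → ℝ → ℝ) : Prop where
  cont_u : IsContinuousInHs s T u
  cont_rho : IsContinuousInHs (s - 1) T ρ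
  weak_deriv : ∀ t ∈ Icc (0 : ℝ) T, HasWeakDeriv (u t) (ux t)
  init_u : u 0 =ᵐ[volume] u₀
  init_rho : ρ 0 =ᵐ[volume] ρ₀
  eq_m : ∀ ψ : ℝ → ℝ, IsTest ψ → ∀ t ∈ Icc (0 : ℝ) T,
    HasDerivWithinAt (fun τ => pairM (u τ) ψ)
      (α * (∫ x, ux t x * ψ x) - b * pairUxM (u t) (ux t) ψ - pairUMx (u t) (ux t) ψ
        - κ * pairRhoRhox (ρ t) ψ) (Icc 0 T) t
  eq_rho : ∀ ψ : ℝ → ℝ, IsTest ψ → ∀ t ∈ Icc (0 : ℝ) T,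
    HasDerivWithinAt (fun τ => ∫ x, ρ τ x * ψ x)
      (-pairURhox (u t) (ux t) (ρ t) ψ - (b - 1) * ∫ x, ux t x * ρ t x * ψ x) (Icc 0 T) t

/-- Sub-multiplicative weight functions on the line. -/
def IsSubmultiplicativeWeight (v : ℝ → ℝ) : Prop :=
  (∀ x, 0 ≤ v x) ∧ ∀ x y, v (x + y) ≤ v x * v y

/-- The positive function `φ` is `v`-moderate. -/
def IsModerate (v φ : ℝ → ℝ) : Prop :=
  (∀ x, 0 < φ x) ∧ ∃ C₀ : ℝ, 0 < C₀ ∧ ∀ x y, φ (x + y) ≤ C₀ * v x * φ y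

/-- Admissible weight functions. -/
def IsAdmissibleWeight (φ : ℝ → ℝ) : Prop :=
  (∀ a c : ℝ, AbsolutelyContinuousOnInterval φ a c) ∧
  (∃ A : ℝ, 0 < A ∧ ∀ᵐ x, |deriv φ x| ≤ A * |φ x|) ∧
  ∃ v : ℝ → ℝ, IsSubmultiplicativeWeight v ∧ (∃ c : ℝ, 0 < c ∧ ∀ x, c ≤ v x) ∧
    Integrable (fun x => v x / Real.exp |x|) volume ∧ IsModerate v φ

/-- `‖f φ‖_p + ‖g φ‖_p + ‖h φ‖_p` in `[0,∞]`. -/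
noncomputable def weightedSum (p : ℝ≥0∞) (φ f g h : ℝ → ℝ) : ℝ≥0∞ :=
  eLpNorm (fun x => f x * φ x) p volume + eLpNorm (fun x => g x * φ x) p volume
    + eLpNorm (fun x => h x * φ x) p volume

/-- `M = sup_{t ∈ [0,T]} (‖u(t)‖_∞ + ‖u_x(t)‖_∞ + ‖ρ(t)‖_∞)` in `[0,∞]`. -/
noncomputable def supNorm (T : ℝ) (u ux ρ : ℝ → ℝ → ℝ) : ℝ≥0∞ :=
  ⨆ t ∈ Icc (0 : ℝ) T,
    (eLpNorm (u t) ∞ volume + eLpNorm (ux t) ∞ volume + eLpNorm (ρ t) ∞ volume)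

end BSystem

/-! The system becomes three transport equations with velocity `u` and zeroth-order nonlocal
sources, and each weighted norm is followed along the flow of `u`. Write `G = e^{-|x|}/2` for the
kernel of `(1 - ∂ₓ²)⁻¹` and `F = -αu + (b/2)u² + ((3-b)/2)u_x² + (κ/2)ρ²`. Along characteristics,
the derivatives of `u`, `u_x`, `ρ` are `-G' * F`, `F - G * F - u_x²`, `(1-b) u_x ρ`. Since `|G'| =
G` and `φ(x) ≤ C₀ v(y) φ(x-y)`, Young's inequality with the integrable kernel `G v` bounds the
weighted norms of the convolutions by that of `F`. As `F` is at most quadratic, the derivatives are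
bounded by a constant times `1 + M` times the sum of the three weighted norms (`wnorm_kconv_le`,
`wnorm_residuals_le`).

The flow over a short time `h` has Lipschitz constant `e^{Mh}` and moves points by at most `Mh`. The
change of variables and the logarithmic Lipschitz bound on `φ` thus cost a factor `e^{(A+1)Mh}`,
uniformly in `p` (`WeakTransport.eventually_wnorm_le`). Grönwall's inequality, in terms of a Dini
derivative, concludes (`weighted_sum_le_mul_exp`).

Three points need care. The solution is only distributional: the Sobolev embedding provides curves
of bounded uniformly continuous functions (`IsSolution.exists_regular`), the nonlocal form comes
from testing with `G * χ`, and a mollifier commutator gives the equations along characteristics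
(`WeakTransport.along_characteristic`). The weighted norms are not known to be finite at positive
times, so `φ` is first replaced by `min(φ, (n+1)e^{-|x|/2})`, which lies in every `L^p` and has
constants independent of `n`. Finally `n → ∞` by Fatou's lemma. -/

namespace BSystem

open Filter Topology FourierTransform
open scoped BoundedContinuousFunction

/-! ### Continuous representatives of Bessel potentials -/

/-- The Fourier multiplier with an `L²` symbol `m`, from `L²` to bounded continuous functions,
followed by the real part. -/
noncomputable def multiplierRe (m : ℝ → ℂ) (hm : MemLp m 2 volume) (w : Lp ℂ 2 (volume : Measure ℝ)) :
    ℝ →ᵇ ℝ :=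
  Complex.reCLM.compLeftContinuousBounded ℝ
    (Real.Lp.fourierTransformInvCLM ℝ ℂ (hm.toLp m • (𝓕 w) : Lp ℂ 1 (volume : Measure ℝ)))

/-- Plancherel, then Hölder `L² · L² → L¹`, then the bounded inverse transform from `L¹` to bounded
continuous functions. Continuity in time with values in `H^s` thereby becomes continuity in the sup
norm. -/
theorem continuous_multiplierRe (m : ℝ → ℂ) (hm : MemLp m 2 volume) :
    Continuous (multiplierRe m hm) := by
  have h1 : Continuous fun W : Lp ℂ 2 (volume : Measure ℝ) =>
      (hm.toLp m • W : Lp ℂ 1 (volume : Measure ℝ)) := by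
    refine AddMonoidHomClass.continuous_of_bound
      (⟨⟨fun W => (hm.toLp m • W : Lp ℂ 1 (volume : Measure ℝ)), ?_⟩, ?_⟩ :
        Lp ℂ 2 (volume : Measure ℝ) →+ Lp ℂ 1 (volume : Measure ℝ)) ‖hm.toLp m‖ ?_
    · exact Lp.smul_zero (𝕜 := ℂ) (E := ℂ) (p := 2) 2 (hm.toLp m)
    · intro a b
      exact Lp.add_smul (r := 1) (hm.toLp m) a b
    · intro W
      exact Lp.norm_smul_le _ _
  have h2 : Continuous fun w : Lp ℂ 2 (volume : Measure ℝ) => 𝓕 w :=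
    (Lp.fourierTransformₗᵢ ℝ ℂ).continuous
  exact (Complex.reCLM.compLeftContinuousBounded ℝ).continuous.comp
    ((Real.Lp.fourierTransformInvCLM ℝ ℂ).continuous.comp (h1.comp h2))

theorem multiplierRe_apply (m : ℝ → ℂ) (hm : MemLp m 2 volume) (w : Lp ℂ 2 (volume : Measure ℝ))
    (x : ℝ) :
    multiplierRe m hm w x
      = (𝓕⁻ (fun ξ => m ξ * (𝓕 w : Lp ℂ 2 (volume : Measure ℝ)) ξ) x).re := by
  simp only [multiplierRe, Real.Lp.fourierTransformInvCLM_apply]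
  change ((Real.Lp.fourierTransformInv _ x : ℂ)).re = _
  rw [Real.Lp.fourierTransformInv_apply]
  congr 1
  apply Real.fourierInv_congr_ae
  have h := Lp.coeFn_lpSMul (r := 1) (hm.toLp m) (𝓕 w : Lp ℂ 2 (volume : Measure ℝ))
  filter_upwards [h, hm.coeFn_toLp] with ξ h1 h2
  rw [h1]
  simp [h2]

theorem integrable_multiplier (m : ℝ → ℂ) (hm : MemLp m 2 volume)
    (W : Lp ℂ 2 (volume : Measure ℝ)) : Integrable (fun ξ => m ξ * W ξ) :=
  hm.integrable_mul (Lp.memLp W)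

/-- By Riemann–Lebesgue the function vanishes at infinity. Uniform continuity later makes the error
of a short time step uniform in the starting point. -/
theorem uniformContinuous_multiplierRe (m : ℝ → ℂ) (hm : MemLp m 2 volume)
    (w : Lp ℂ 2 (volume : Measure ℝ)) : UniformContinuous (multiplierRe m hm w) := by
  have h0 : Tendsto (multiplierRe m hm w) (cocompact ℝ) (𝓝 0) := by
    have h1 := Real.zero_at_infty_fourier
      (fun ξ => m ξ * (𝓕 w : Lp ℂ 2 (volume : Measure ℝ)) ξ)
    have h2 : Tendsto (fun x : ℝ => -x) (cocompact ℝ) (cocompact ℝ) :=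
      (Homeomorph.neg ℝ).isClosedEmbedding.tendsto_cocompact
    have h3 := (Complex.continuous_re.tendsto 0).comp (h1.comp h2)
    refine (h3.congr fun x => ?_)
    rw [multiplierRe_apply, Real.fourierInv_eq_fourier_neg]
    rfl
  exact (multiplierRe m hm w).continuous.uniformContinuous_of_tendsto_cocompact h0

theorem hasDerivAt_multiplierRe (m : ℝ → ℂ) (hm : MemLp m 2 volume)
    (hm' : MemLp (fun ξ : ℝ => 2 * Real.pi * Complex.I * ξ * m ξ) 2 volume)
    (w : Lp ℂ 2 (volume : Measure ℝ)) (x : ℝ) :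
    HasDerivAt (multiplierRe m hm w) (multiplierRe _ hm' w x) x := by
  set W := (𝓕 w : Lp ℂ 2 (volume : Measure ℝ)) with hW
  have i1 := integrable_multiplier m hm W
  have i2 : Integrable (fun ξ : ℝ => ξ • (m ξ * W ξ)) := by
    have := (integrable_multiplier _ hm' W).const_mul (2 * Real.pi * Complex.I)⁻¹
    refine this.congr (Eventually.of_forall fun ξ => ?_)
    have : (Real.pi : ℂ) ≠ 0 := by exact_mod_cast Real.pi_ne_zero
    simp only [Complex.real_smul]
    field_simp
  -- The inverse transform at `x` is the transform at `-x`; the reflection turns the factor `-2πiξ`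
  -- into `2πiξ`.
  have hd := Real.hasDerivAt_fourier i1 i2 (-x)
  have hd2 : HasDerivAt (fun y => 𝓕 (fun ξ => m ξ * W ξ) (-y))
      (-(𝓕 (fun x : ℝ ↦ (-2 * Real.pi * Complex.I * x) • (m x * W x)) (-x))) x := by
    have := hd.scomp x (hasDerivAt_neg x)
    simpa using! this
  have hd3 := Complex.reCLM.hasFDerivAt.comp_hasDerivAt x hd2
  have e1 : (multiplierRe m hm w : ℝ → ℝ)
      = Complex.reCLM ∘ (fun y => 𝓕 (fun ξ => m ξ * W ξ) (-y)) := by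
    ext y
    rw [multiplierRe_apply, Real.fourierInv_eq_fourier_neg]
    rfl
  rw [e1]
  convert! hd3 using 1
  rw [multiplierRe_apply, Real.fourierInv_eq_fourier_neg]
  simp only [Complex.reCLM_apply]
  rw [Real.fourier_eq, Real.fourier_eq, ← integral_neg]
  congr 2
  ext ξ
  rw [← smul_neg]
  congr 1
  simp only [smul_eq_mul]
  ring

/-- Tempered growth lets `m` act on distributions, and `m ∈ L²` makes the inverse transform an
absolutely convergent integral. The two readings agree against test functions by Fubini. -/
theorem ae_eq_multiplierRe_of_fourier {m : ℝ → ℂ} (hm : MemLp m 2 volume)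
    (hmt : m.HasTemperateGrowth) {f : ℝ → ℝ} (hf : MemLp (fun x => (f x : ℂ)) 2 volume)
    (w : Lp ℂ 2 (volume : Measure ℝ))
    (h : ((hf.toLp _ : Lp ℂ 2 (volume : Measure ℝ)) : 𝓢'(ℝ, ℂ))
      = TemperedDistribution.fourierMultiplierCLM ℂ m (w : 𝓢'(ℝ, ℂ))) :
    f =ᵐ[volume] multiplierRe m hm w := by
  set W := (𝓕 w : Lp ℂ 2 (volume : Measure ℝ)) with hW
  have i1 := integrable_multiplier m hm W
  set g : ℝ → ℂ := 𝓕⁻ (fun ξ => m ξ * W ξ) with hg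
  have hgc : Continuous g := by
    have hh := Real.Lp.coe_fourierTransformInv (hm.toLp m • W : Lp ℂ 1 (volume : Measure ℝ))
    have h2 : g = (Real.Lp.fourierTransformInv (hm.toLp m • W : Lp ℂ 1 (volume : Measure ℝ)) :
        ℝ → ℂ) := by
      rw [hh]
      ext x
      apply Real.fourierInv_congr_ae
      have h := Lp.coeFn_lpSMul (r := 1) (hm.toLp m) W
      filter_upwards [h, hm.coeFn_toLp] with ξ h1 h2
      rw [h1]
      simp [h2]
    rw [h2]
    exact (Real.Lp.fourierTransformInv _).continuous
  have key : (fun x => (f x : ℂ)) =ᵐ[volume] g := by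
    apply ae_eq_of_integral_contDiff_smul_eq
    · exact hf.locallyIntegrable (by norm_num)
    · exact hgc.locallyIntegrable
    · intro ψ hψ hψc
      have hg₁ : HasCompactSupport (Complex.ofRealCLM ∘ ψ) := hψc.comp_left rfl
      have hg₂ : ContDiff ℝ ∞ (Complex.ofRealCLM ∘ ψ) := by fun_prop
      set Ψ : 𝓢(ℝ, ℂ) := hg₁.toSchwartzMap hg₂ with hΨ
      have hΨa : ∀ x, Ψ x = (ψ x : ℂ) := fun x => rfl
      have e := congrArg (fun D : 𝓢'(ℝ, ℂ) => D Ψ) h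

      rw [Lp.toTemperedDistribution_apply,
        TemperedDistribution.fourierMultiplierCLM_apply, TemperedDistribution.fourierInv_apply,
        Lp.fourier_toTemperedDistribution_eq, TemperedDistribution.smulLeftCLM_apply_apply,
        Lp.toTemperedDistribution_apply] at e
      calc ∫ x, ψ x • (f x : ℂ) = ∫ x, Ψ x • (hf.toLp _ : Lp ℂ 2 (volume : Measure ℝ)) x := by
            apply integral_congr_ae
            filter_upwards [hf.coeFn_toLp] with x hx
            rw [hx, hΨa]
            simp
        _ = ∫ x, (𝓕⁻ Ψ) x • (m x * W x) := by
            rw [e]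
            apply integral_congr_ae
            refine Eventually.of_forall fun x => ?_
            simp only [smul_eq_mul, SchwartzMap.smulLeftCLM_apply_apply hmt]
            ring
        _ = ∫ x, Ψ x • g x := by
            rw [SchwartzMap.fourierInv_coe]
            have := VectorFourier.integral_fourierIntegral_smul_eq_flip (𝕜 := ℝ)
              (μ := volume) (ν := volume) (e := Real.fourierChar) (L := -(innerₗ ℝ))
              (f := (Ψ : ℝ → ℂ)) (g := fun x => m x * W x)
              Real.continuous_fourierChar (by fun_prop) Ψ.integrable i1
            convert! this using 3 with x
            rw [hg, Real.fourierInv_eq]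
            simp [VectorFourier.fourierIntegral, mul_comm]
        _ = ∫ x, ψ x • g x := by
            apply integral_congr_ae
            refine Eventually.of_forall fun x => ?_
            simp [hΨa]
  filter_upwards [key] with x hx
  rw [multiplierRe_apply, ← hW]
  change f x = (g x).re
  rw [← hx, Complex.ofReal_re]

theorem memLp_two_bessel {s : ℝ} (hs : 1 / 2 < s) :
    MemLp (fun ξ : ℝ => (((1 + ‖ξ‖ ^ 2) ^ (-s / 2) : ℝ) : ℂ)) 2 volume := by
  have : MemLp (fun x : ℝ ↦ (1 + ‖x‖ ^ 2) ^ (-s / 2)) 2 := by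
    rw [memLp_two_iff_integrable_sq (by
      have : (fun x : ℝ ↦ (1 + ‖x‖ ^ 2) ^ (-s / 2)).HasTemperateGrowth := by fun_prop
      exact this.1.continuous.aestronglyMeasurable)]
    have h := integrable_rpow_neg_one_add_norm_sq (E := ℝ) (μ := volume) (r := 2 * s)
      (by simp; linarith)
    refine h.congr (Eventually.of_forall fun x => ?_)
    simp only
    rw [← Real.rpow_mul_natCast (by positivity)]
    congr 1
    push_cast
    ring
  exact this.ofReal

/-- Since `|ξ| ≤ (1 + ξ²)^{1/2}`, the factor `ξ` costs one order, and `s - 1 > 1/2` remains. -/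
theorem memLp_two_mul_bessel {s : ℝ} (hs : 3 / 2 < s) :
    MemLp (fun ξ : ℝ => 2 * Real.pi * Complex.I * ξ *
      (((1 + ‖ξ‖ ^ 2) ^ (-s / 2) : ℝ) : ℂ)) 2 volume := by
  have h1 := (memLp_two_bessel (s := s - 1) (by linarith)).const_mul (2 * Real.pi * Complex.I)
  have hmeas : AEStronglyMeasurable (fun ξ : ℝ => 2 * Real.pi * Complex.I * ξ *
      (((1 + ‖ξ‖ ^ 2) ^ (-s / 2) : ℝ) : ℂ)) volume := by
    have : (fun ξ : ℝ => (((1 + ‖ξ‖ ^ 2) ^ (-s / 2) : ℝ) : ℂ)).HasTemperateGrowth := by fun_prop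
    have := this.1.continuous
    exact (by fun_prop : Continuous _).aestronglyMeasurable
  refine h1.mono hmeas (Eventually.of_forall fun ξ => ?_)
  simp only [norm_mul, Complex.norm_real]
  rw [mul_assoc _ ‖ξ‖]
  gcongr
  have h2 : (1 + ‖ξ‖ ^ 2) ^ (-(s - 1) / 2) = (1 + ‖ξ‖ ^ 2) ^ (1 / 2 : ℝ) * (1 + ‖ξ‖ ^ 2) ^ (-s / 2) := by
    rw [← Real.rpow_add (by positivity)]
    congr 1
    ring
  rw [h2, norm_mul]
  gcongr
  rw [← Real.sqrt_eq_rpow, Real.norm_of_nonneg (Real.sqrt_nonneg _)]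
  apply Real.le_sqrt_of_sq_le
  linarith

theorem HasBesselPotential.ae_eq {s : ℝ} (hs : 1 / 2 < s) {f : ℝ → ℝ}
    {w : Lp ℂ 2 (volume : Measure ℝ)} (h : HasBesselPotential s f w) :
    f =ᵐ[volume] multiplierRe _ (memLp_two_bessel hs) w := by
  obtain ⟨hf, h⟩ := h
  refine ae_eq_multiplierRe_of_fourier _ (by fun_prop) hf w ?_
  rw [← h]
  have h2 := (TemperedDistribution.besselPotential_neg_apply_eq_iff s _
    ((hf.toLp _ : Lp ℂ 2 (volume : Measure ℝ)) : 𝓢'(ℝ, ℂ))).mpr rfl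
  exact h2.symm

/-! ### Regular representatives of solutions -/

theorem IsTest.isTest_deriv {ψ : ℝ → ℝ} (h : IsTest ψ) : IsTest (deriv ψ) :=
  ⟨h.1.deriv' , h.2.deriv⟩

theorem IsTest.hasDerivAt {ψ : ℝ → ℝ} (h : IsTest ψ) (x : ℝ) :
    HasDerivAt ψ (deriv ψ x) x :=
  (h.1.differentiable (by simp) x).hasDerivAt

theorem IsTest.continuous {ψ : ℝ → ℝ} (h : IsTest ψ) : Continuous ψ := h.1.continuous

theorem IsTest.integrable {ψ : ℝ → ℝ} (h : IsTest ψ) : Integrable ψ :=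
  h.continuous.integrable_of_hasCompactSupport h.2

theorem IsTest.integrable_mul {ψ g : ℝ → ℝ} (h : IsTest ψ) (hg : Continuous g) :
    Integrable fun x => g x * ψ x :=
  (hg.mul h.continuous).integrable_of_hasCompactSupport h.2.mul_left

theorem IsTest.integral_mul_deriv {ψ F G : ℝ → ℝ} (h : IsTest ψ)
    (hF : ∀ x, HasDerivAt F (G x) x) (hG : Continuous G) :
    ∫ x, F x * deriv ψ x = -∫ x, G x * ψ x := by
  have hFc : Continuous F := continuous_iff_continuousAt.2 fun x => (hF x).continuousAt
  exact integral_mul_deriv_eq_deriv_mul_of_integrable (fun x _ => hF x)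
    (fun x _ => h.hasDerivAt x) (h.isTest_deriv.integrable_mul hFc) (h.integrable_mul hG)
    (h.integrable_mul hFc)

theorem HasWeakDeriv.ae_eq {f g F G : ℝ → ℝ} (h : HasWeakDeriv f g) (hf : f =ᵐ[volume] F)
    (hF : ∀ x, HasDerivAt F (G x) x) (hG : Continuous G) : g =ᵐ[volume] G := by
  apply ae_eq_of_integral_contDiff_smul_eq h.2.1 hG.locallyIntegrable
  intro ψ hψ hψc
  have hT : IsTest ψ := ⟨hψ, hψc⟩
  have h1 := h.2.2 ψ hT
  have h2 := hT.integral_mul_deriv hF hG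
  have h3 : ∫ x, f x * deriv ψ x = ∫ x, F x * deriv ψ x := by
    apply integral_congr_ae
    filter_upwards [hf] with x hx
    rw [hx]
  simp only [smul_eq_mul, mul_comm (ψ _)]
  linarith

/-- `V` comes from the same potential as `U`, with the symbol multiplied by `2πiξ`, so it is the
classical derivative of `U`; uniqueness of weak derivatives identifies it with `ux`. The curves are
extended constantly in time outside `[0,T]`, so that they are continuous on all of `ℝ`. -/
theorem IsSolution.exists_regular {α b κ s T : ℝ} {u₀ ρ₀ : ℝ → ℝ} {u ux ρ : ℝ → ℝ → ℝ}
    (h : IsSolution α b κ s T u₀ ρ₀ u ux ρ) (hs : 3 / 2 < s) (hT : 0 ≤ T) :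
    ∃ U V R : ℝ → ℝ →ᵇ ℝ, Continuous U ∧ Continuous V ∧ Continuous R ∧
      (∀ t, UniformContinuous (U t)) ∧ (∀ t, UniformContinuous (V t)) ∧
      (∀ t, UniformContinuous (R t)) ∧ (∀ t x, HasDerivAt (U t) (V t x) x) ∧
      ∀ t ∈ Icc (0 : ℝ) T, u t =ᵐ[volume] U t ∧ ux t =ᵐ[volume] V t ∧ ρ t =ᵐ[volume] R t := by
  obtain ⟨w, hw, hwu⟩ := h.cont_u
  obtain ⟨z, hz, hzρ⟩ := h.cont_rho
  have hw' : Continuous (IccExtend hT ((Icc 0 T).domRestrict w)) :=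
    (continuousOn_iff_continuous_domRestrict.1 hw).Icc_extend'
  have hz' : Continuous (IccExtend hT ((Icc 0 T).domRestrict z)) :=
    (continuousOn_iff_continuous_domRestrict.1 hz).Icc_extend'
  have hs1 : 1 / 2 < s := by linarith
  have hs2 : 1 / 2 < s - 1 := by linarith
  refine ⟨fun t => multiplierRe _ (memLp_two_bessel hs1) (IccExtend hT ((Icc 0 T).domRestrict w) t),
    fun t => multiplierRe _ (memLp_two_mul_bessel hs) (IccExtend hT ((Icc 0 T).domRestrict w) t),
    fun t => multiplierRe _ (memLp_two_bessel hs2) (IccExtend hT ((Icc 0 T).domRestrict z) t),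
    (continuous_multiplierRe _ _).comp hw', (continuous_multiplierRe _ _).comp hw',
    (continuous_multiplierRe _ _).comp hz', fun t => uniformContinuous_multiplierRe _ _ _,
    fun t => uniformContinuous_multiplierRe _ _ _, fun t => uniformContinuous_multiplierRe _ _ _,
    fun t x => hasDerivAt_multiplierRe _ _ _ _ _, fun t ht => ?_⟩
  have e1 : IccExtend hT ((Icc 0 T).domRestrict w) t = w t := by
    rw [IccExtend_of_mem hT _ ht]; rfl
  have e2 : IccExtend hT ((Icc 0 T).domRestrict z) t = z t := by
    rw [IccExtend_of_mem hT _ ht]; rfl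
  simp only [e1, e2]
  have hu := (hwu t ht).ae_eq hs1
  exact ⟨hu, (h.weak_deriv t ht).ae_eq hu (fun x => hasDerivAt_multiplierRe _ _ _ _ _)
    (multiplierRe _ _ _).continuous, (hzρ t ht).ae_eq hs2⟩

end BSystem

namespace BSystem

open Filter Topology
open scoped BoundedContinuousFunction Convolution

/-! ### Pairing bounded continuous functions with integrable functions -/

theorem integrable_bcf_mul (f : ℝ →ᵇ ℝ) {g : ℝ → ℝ} (hg : Integrable g) :
    Integrable fun x => f x * g x :=
  hg.bdd_mul f.continuous.aestronglyMeasurable (Eventually.of_forall f.norm_coe_le_norm)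

theorem abs_integral_bcf_mul_le (f : ℝ →ᵇ ℝ) {g : ℝ → ℝ} (hg : Integrable g) :
    |∫ x, f x * g x| ≤ ‖f‖ * ∫ x, |g x| := by
  rw [← integral_const_mul]
  refine norm_integral_le_of_norm_le (f := fun x => f x * g x) (hg.abs.const_mul _) (Eventually.of_forall fun x => ?_)
  rw [norm_mul]
  exact mul_le_mul_of_nonneg_right (f.norm_coe_le_norm x) (abs_nonneg _)

theorem continuous_integral_bcf_mul {g : ℝ → ℝ} (hg : Integrable g) :
    Continuous fun f : ℝ →ᵇ ℝ => ∫ x, f x * g x := by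
  refine AddMonoidHomClass.continuous_of_bound
    (⟨⟨fun f : ℝ →ᵇ ℝ => ∫ x, f x * g x, ?_⟩, ?_⟩ : (ℝ →ᵇ ℝ) →+ ℝ) (∫ x, |g x|) ?_
  · simp
  · intro a b
    rw [← integral_add (integrable_bcf_mul a hg) (integrable_bcf_mul b hg)]
    simp [add_mul]
  · intro f
    rw [mul_comm]
    exact abs_integral_bcf_mul_le f hg

/-! ### Convolution with an integrable kernel -/

/-- Convolution of `F` with the kernel `k`. -/
noncomputable def kconv (k F : ℝ → ℝ) (x : ℝ) : ℝ := ∫ y, k y * F (x - y)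

theorem kconv_eq_convolution (k F : ℝ → ℝ) :
    kconv k F = k ⋆[ContinuousLinearMap.mul ℝ ℝ] F := by
  ext x
  simp [kconv, convolution_def]

/-- Convolution with an integrable kernel, on bounded continuous functions. -/
noncomputable def kconvBCF (k : ℝ → ℝ) (hk : Integrable k) (F : ℝ →ᵇ ℝ) : ℝ →ᵇ ℝ :=
  BoundedContinuousFunction.ofNormedAddCommGroup (kconv k F)
    (by
      refine continuous_of_dominated (bound := fun y => |k y| * ‖F‖) (fun x => ?_) (fun x => ?_)
        (hk.abs.mul_const _) (Eventually.of_forall fun y => by fun_prop)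
      · exact hk.aestronglyMeasurable.mul (by fun_prop)
      · refine Eventually.of_forall fun y => ?_
        rw [norm_mul]
        exact mul_le_mul_of_nonneg_left (F.norm_coe_le_norm _) (abs_nonneg _))
    ((∫ y, |k y|) * ‖F‖)
    (by
      intro x
      rw [← integral_mul_const]
      refine norm_integral_le_of_norm_le (hk.abs.mul_const _) (Eventually.of_forall fun y => ?_)
      rw [norm_mul]
      exact mul_le_mul_of_nonneg_left (F.norm_coe_le_norm _) (abs_nonneg _))

theorem kconvBCF_apply (k : ℝ → ℝ) (hk : Integrable k) (F : ℝ →ᵇ ℝ) (x : ℝ) :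
    kconvBCF k hk F x = ∫ y, k y * F (x - y) := rfl

theorem integrable_kernel_mul {k : ℝ → ℝ} (hk : Integrable k) (F : ℝ →ᵇ ℝ) (x : ℝ) :
    Integrable fun y => k y * F (x - y) := by
  have h := integrable_bcf_mul (F.compContinuous ⟨fun y => x - y, by fun_prop⟩) hk
  simpa [mul_comm] using h

theorem continuous_kconvBCF {k : ℝ → ℝ} (hk : Integrable k) : Continuous (kconvBCF k hk) := by
  refine AddMonoidHomClass.continuous_of_bound
    (⟨⟨kconvBCF k hk, ?_⟩, ?_⟩ : (ℝ →ᵇ ℝ) →+ (ℝ →ᵇ ℝ)) (∫ x, |k x|) ?_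
  · ext x
    simp [kconvBCF_apply]
  · intro a b
    ext x
    simp only [kconvBCF_apply, BoundedContinuousFunction.coe_add, Pi.add_apply]
    rw [← integral_add (integrable_kernel_mul hk a x) (integrable_kernel_mul hk b x)]
    simp [mul_add]
  · intro F
    refine BoundedContinuousFunction.norm_ofNormedAddCommGroup_le _ (by positivity) fun x => ?_
    rw [← integral_mul_const]
    refine norm_integral_le_of_norm_le (hk.abs.mul_const _) (Eventually.of_forall fun y => ?_)
    rw [norm_mul]
    exact mul_le_mul_of_nonneg_left (F.norm_coe_le_norm _) (abs_nonneg _)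

theorem uniformContinuous_kconvBCF {k : ℝ → ℝ} (hk : Integrable k) {F : ℝ →ᵇ ℝ}
    (hF : UniformContinuous F) : UniformContinuous (kconvBCF k hk F) := by
  rw [Metric.uniformContinuous_iff] at hF ⊢
  intro ε hε
  set K := ∫ y, |k y| with hK
  have hK0 : 0 ≤ K := by positivity
  obtain ⟨δ, hδ, h⟩ := hF (ε / (K + 1)) (by positivity)
  refine ⟨δ, hδ, fun {a b} hab => ?_⟩
  rw [Real.dist_eq, kconvBCF_apply, kconvBCF_apply,
    ← integral_sub (integrable_kernel_mul hk F a) (integrable_kernel_mul hk F b)]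
  calc |∫ y, (k y * F (a - y) - k y * F (b - y))| ≤ ∫ y, |k y| * (ε / (K + 1)) := by
        refine norm_integral_le_of_norm_le (f := fun y => k y * F (a - y) - k y * F (b - y))
          (hk.abs.mul_const _) (Eventually.of_forall fun y => ?_)
        rw [← mul_sub, norm_mul]
        refine mul_le_mul_of_nonneg_left ?_ (abs_nonneg _)
        exact (h (by simpa using hab)).le
    _ = K * (ε / (K + 1)) := by rw [integral_mul_const]
    _ < ε := by
        rw [mul_div_assoc', div_lt_iff₀ (by positivity)]
        nlinarith

/-- Fubini and a translation: the transpose of convolution with `k` is convolution with the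
reflected kernel, so only the parity of `k` will matter. -/
theorem integral_kconv_mul {k χ : ℝ → ℝ} (hk : Integrable k) (hχ : Integrable χ) (F : ℝ →ᵇ ℝ) :
    ∫ x, F x * kconv k χ x = ∫ z, χ z * ∫ y, k y * F (z + y) := by
  have h1 : Integrable (fun p : ℝ × ℝ => F p.1 * (k p.2 * χ (p.1 - p.2)))
      (volume.prod volume) := by
    have := hk.convolution_integrand (ContinuousLinearMap.mul ℝ ℝ) hχ
    refine Integrable.bdd_mul (c := ‖F‖) (by simpa using this) ?_
      (Eventually.of_forall fun p => F.norm_coe_le_norm _)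
    exact (F.continuous.comp continuous_fst).aestronglyMeasurable
  have h2 : Integrable (fun p : ℝ × ℝ => F (p.2 + p.1) * (k p.1 * χ p.2))
      (volume.prod volume) := by
    refine Integrable.bdd_mul (c := ‖F‖) (hk.mul_prod hχ) ?_
      (Eventually.of_forall fun p => F.norm_coe_le_norm _)
    exact (F.continuous.comp (continuous_snd.add continuous_fst)).aestronglyMeasurable
  calc ∫ x, F x * kconv k χ x = ∫ x, ∫ y, F x * (k y * χ (x - y)) := by
        simp only [kconv, integral_const_mul]
    _ = ∫ y, ∫ x, F x * (k y * χ (x - y)) := integral_integral_swap h1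
    _ = ∫ y, ∫ z, F (z + y) * (k y * χ z) := by
        congr 1
        ext y
        rw [← integral_add_right_eq_self (fun x => F x * (k y * χ (x - y))) y]
        simp
    _ = ∫ z, ∫ y, F (z + y) * (k y * χ z) := integral_integral_swap h2
    _ = ∫ z, χ z * ∫ y, k y * F (z + y) := by
        congr 1
        ext z
        rw [← integral_const_mul]
        congr 1
        ext y
        ring

/-! ### The kernel of `(1 - ∂²)⁻¹` and its derivative -/

/-- The kernel of `(1 - ∂²)⁻¹`. -/
noncomputable def green (y : ℝ) : ℝ := Real.exp (-|y|) / 2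

/-- The derivative of `green`. -/
noncomputable def greenDeriv (y : ℝ) : ℝ := if 0 < y then -green y else green y

theorem integrable_exp_neg_mul_abs {c : ℝ} (hc : 0 < c) :
    Integrable fun y : ℝ => Real.exp (-c * |y|) := by
  rw [← integrableOn_univ, ← Iic_union_Ioi (a := (0 : ℝ))]
  refine IntegrableOn.union ?_ ?_
  · refine (integrableOn_exp_mul_Iic hc 0).congr_fun (fun y hy => ?_) measurableSet_Iic
    simp [abs_of_nonpos (mem_Iic.1 hy)]
  · refine (integrableOn_exp_mul_Ioi (neg_lt_zero.2 hc) 0).congr_fun (fun y hy => ?_)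
      measurableSet_Ioi
    simp [abs_of_pos (mem_Ioi.1 hy)]

theorem integrable_green : Integrable green := by
  have : Integrable fun y : ℝ => Real.exp (-|y|) := by
    simpa using integrable_exp_neg_mul_abs one_pos
  exact this.div_const 2

theorem abs_greenDeriv (y : ℝ) : |greenDeriv y| = green y := by
  have : 0 ≤ green y := by unfold green; positivity
  unfold greenDeriv
  split_ifs <;> simp [abs_of_nonneg this]

theorem integrable_greenDeriv : Integrable greenDeriv := by
  refine integrable_green.mono' ?_ (Eventually.of_forall fun y => (abs_greenDeriv y).le)
  have : Measurable greenDeriv := by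
    unfold greenDeriv green
    exact Measurable.ite measurableSet_Ioi (by fun_prop) (by fun_prop)
  exact this.aestronglyMeasurable

theorem integral_green_mul_eq {h : ℝ → ℝ} (hh : Integrable fun y => green y * h y) :
    ∫ y, green y * h y = (1 / 2) * (∫ y in Iic (0 : ℝ), Real.exp y * h y)
      + (1 / 2) * ∫ y in Ioi (0 : ℝ), Real.exp (-y) * h y := by
  rw [← intervalIntegral.integral_Iic_add_Ioi hh.integrableOn hh.integrableOn (b := 0),
    ← integral_const_mul, ← integral_const_mul]
  congr 1
  · refine setIntegral_congr_fun measurableSet_Iic fun y hy => ?_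
    simp only [green, abs_of_nonpos (mem_Iic.1 hy), neg_neg]
    ring
  · refine setIntegral_congr_fun measurableSet_Ioi fun y hy => ?_
    simp only [green, abs_of_pos (mem_Ioi.1 hy)]
    ring

theorem integral_greenDeriv_mul_eq {h : ℝ → ℝ} (hh : Integrable fun y => greenDeriv y * h y) :
    ∫ y, greenDeriv y * h y = (1 / 2) * (∫ y in Iic (0 : ℝ), Real.exp y * h y)
      - (1 / 2) * ∫ y in Ioi (0 : ℝ), Real.exp (-y) * h y := by
  rw [← intervalIntegral.integral_Iic_add_Ioi hh.integrableOn hh.integrableOn (b := 0),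
    ← integral_const_mul, ← integral_const_mul, sub_eq_add_neg, ← integral_neg]
  congr 1
  · refine setIntegral_congr_fun measurableSet_Iic fun y hy => ?_
    simp only [greenDeriv, not_lt.2 (mem_Iic.1 hy), if_false, green, abs_of_nonpos (mem_Iic.1 hy),
      neg_neg]
    ring
  · refine setIntegral_congr_fun measurableSet_Ioi fun y hy => ?_
    simp only [greenDeriv, mem_Ioi.1 hy, if_true, green, abs_of_pos (mem_Ioi.1 hy)]
    ring

theorem IsTest.integral_Ioi_exp_neg_mul_deriv {h : ℝ → ℝ} (hh : IsTest h) :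
    ∫ y in Ioi (0 : ℝ), Real.exp (-y) * deriv h y
      = -h 0 + ∫ y in Ioi (0 : ℝ), Real.exp (-y) * h y := by
  have i1 : Integrable fun y => Real.exp (-y) * deriv h y := hh.isTest_deriv.integrable_mul (by fun_prop)
  have i2 : Integrable fun y => Real.exp (-y) * h y := hh.integrable_mul (by fun_prop)
  have hc : HasCompactSupport fun y => Real.exp (-y) * h y := hh.2.mul_left
  have hd : ∀ y ∈ Ici (0 : ℝ), HasDerivAt (fun y => Real.exp (-y) * h y)
      (Real.exp (-y) * deriv h y - Real.exp (-y) * h y) y := by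
    intro y _
    have := ((hasDerivAt_neg y).exp).mul (hh.hasDerivAt y)
    convert! this using 1
    ring
  have ht : Tendsto (fun y => Real.exp (-y) * h y) atTop (𝓝 0) :=
    hc.is_zero_at_infty.mono_left atTop_le_cocompact
  have := integral_Ioi_of_hasDerivAt_of_tendsto' hd (i1.sub i2).integrableOn ht
  rw [integral_sub i1.integrableOn i2.integrableOn] at this
  simp only [neg_zero, Real.exp_zero, one_mul, zero_sub] at this
  linarith

theorem IsTest.integral_Iic_exp_mul_deriv {h : ℝ → ℝ} (hh : IsTest h) :
    ∫ y in Iic (0 : ℝ), Real.exp y * deriv h y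
      = h 0 - ∫ y in Iic (0 : ℝ), Real.exp y * h y := by
  have i1 : Integrable fun y => Real.exp y * deriv h y := hh.isTest_deriv.integrable_mul (by fun_prop)
  have i2 : Integrable fun y => Real.exp y * h y := hh.integrable_mul (by fun_prop)
  have hc : HasCompactSupport fun y => Real.exp y * h y := hh.2.mul_left
  have hd : ∀ y ∈ Iic (0 : ℝ), HasDerivAt (fun y => Real.exp y * h y)
      (Real.exp y * deriv h y + Real.exp y * h y) y := by
    intro y _
    have := (Real.hasDerivAt_exp y).mul (hh.hasDerivAt y)
    convert! this using 1
    ring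
  have ht : Tendsto (fun y => Real.exp y * h y) atBot (𝓝 0) :=
    hc.is_zero_at_infty.mono_left atBot_le_cocompact
  have := integral_Iic_of_hasDerivAt_of_tendsto' hd (i1.add i2).integrableOn ht
  rw [integral_add i1.integrableOn i2.integrableOn] at this
  simp only [Real.exp_zero, one_mul, sub_zero] at this
  linarith

theorem IsTest.comp_const_sub {χ : ℝ → ℝ} (hχ : IsTest χ) (x : ℝ) : IsTest fun y => χ (x - y) :=
  ⟨hχ.1.comp (contDiff_const.sub contDiff_id),
    hχ.2.comp_homeomorph (Homeomorph.subLeft x)⟩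

theorem IsTest.integrable_kernel_mul {k h : ℝ → ℝ} (hk : Integrable k) (hh : IsTest h) :
    Integrable fun y => k y * h y := by
  obtain ⟨C, hC⟩ := hh.2.exists_bound_of_continuous hh.continuous
  exact hk.mul_bdd hh.continuous.aestronglyMeasurable (Eventually.of_forall hC)

/-- Integration by parts on each half-line; the boundary terms at the origin cancel because `green`
is continuous there. -/
theorem IsTest.kconv_green_deriv {χ : ℝ → ℝ} (hχ : IsTest χ) (x : ℝ) :
    kconv green (deriv χ) x = kconv greenDeriv χ x := by
  have hh := hχ.comp_const_sub x
  have e1 : kconv green (deriv χ) x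
      = -∫ y, green y * deriv (fun y => χ (x - y)) y := by
    simp [kconv, deriv_comp_const_sub, integral_neg]
  rw [e1, integral_green_mul_eq (hh.isTest_deriv.integrable_kernel_mul integrable_green),
    hh.integral_Ioi_exp_neg_mul_deriv, hh.integral_Iic_exp_mul_deriv, kconv,
    integral_greenDeriv_mul_eq (hh.integrable_kernel_mul integrable_greenDeriv)]
  ring

/-- This is `G'' = G - δ`: `greenDeriv` jumps by `-1` at the origin, so here the two boundary terms
add up to `-χ x`. -/
theorem IsTest.kconv_greenDeriv_deriv {χ : ℝ → ℝ} (hχ : IsTest χ) (x : ℝ) :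
    kconv greenDeriv (deriv χ) x = kconv green χ x - χ x := by
  have hh := hχ.comp_const_sub x
  have e1 : kconv greenDeriv (deriv χ) x
      = -∫ y, greenDeriv y * deriv (fun y => χ (x - y)) y := by
    simp [kconv, deriv_comp_const_sub, integral_neg]
  rw [e1, integral_greenDeriv_mul_eq (hh.isTest_deriv.integrable_kernel_mul integrable_greenDeriv),
    hh.integral_Ioi_exp_neg_mul_deriv, hh.integral_Iic_exp_mul_deriv, kconv,
    integral_green_mul_eq (hh.integrable_kernel_mul integrable_green)]
  simp only [sub_zero]
  ring

theorem IsTest.hasDerivAt_kconv {k χ : ℝ → ℝ} (hk : Integrable k) (hχ : IsTest χ) (x : ℝ) :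
    HasDerivAt (kconv k χ) (kconv k (deriv χ) x) x := by
  rw [kconv_eq_convolution, kconv_eq_convolution]
  exact hχ.2.hasDerivAt_convolution_right _ hk.locallyIntegrable (hχ.1.of_le (by simp)) x

theorem IsTest.contDiff_kconv {k χ : ℝ → ℝ} (hk : Integrable k) (hχ : IsTest χ) :
    ContDiff ℝ ∞ (kconv k χ) := by
  rw [kconv_eq_convolution]
  exact hχ.2.contDiff_convolution_right _ hk.locallyIntegrable hχ.1

theorem IsTest.integrable_kconv {k χ : ℝ → ℝ} (hk : Integrable k) (hχ : IsTest χ) :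
    Integrable (kconv k χ) := by
  rw [kconv_eq_convolution]
  exact hk.integrable_convolution _ hχ.integrable

theorem integral_mul_kconv_green {χ : ℝ → ℝ} (hχ : Integrable χ) (F : ℝ →ᵇ ℝ) :
    ∫ x, F x * kconv green χ x = ∫ x, kconvBCF green integrable_green F x * χ x := by
  rw [integral_kconv_mul integrable_green hχ]
  congr 1
  ext z
  rw [mul_comm, kconvBCF_apply]
  congr 1
  rw [← integral_neg_eq_self]
  simp [green, sub_eq_add_neg]

theorem integral_mul_kconv_greenDeriv {χ : ℝ → ℝ} (hχ : Integrable χ) (F : ℝ →ᵇ ℝ) :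
    ∫ x, F x * kconv greenDeriv χ x
      = -∫ x, kconvBCF greenDeriv integrable_greenDeriv F x * χ x := by
  rw [integral_kconv_mul integrable_greenDeriv hχ, ← integral_neg]
  congr 1
  ext z
  rw [mul_comm, kconvBCF_apply, ← neg_mul, ← integral_neg]
  congr 1
  rw [← integral_neg_eq_self]
  apply integral_congr_ae
  -- `greenDeriv` is odd only off the origin, where it takes the value `1/2`.
  have : ∀ᵐ y : ℝ, y ≠ 0 := by simp [ae_iff]
  filter_upwards [this] with y hy
  have e : greenDeriv (-y) = -greenDeriv y := by
    rcases lt_or_gt_of_ne hy with h | h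
    · simp [greenDeriv, green, h, not_lt.2 h.le]
    · simp [greenDeriv, green, h, not_lt.2 h.le]
  rw [e]
  simp [sub_eq_add_neg]

end BSystem

namespace BSystem

open Filter Topology
open scoped BoundedContinuousFunction Convolution

/-! ### Integrated form of a differential equation on `[0,T]` -/

/-- The integrated form of an equation survives a limit in the test function; the differential form
is recovered afterwards by the converse below. -/
theorem eq_add_integral_of_hasDerivWithinAt {T : ℝ} {f f' : ℝ → ℝ}
    (h : ∀ t ∈ Icc (0 : ℝ) T, HasDerivWithinAt f (f' t) (Icc 0 T) t) (hf' : Continuous f')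
    {t : ℝ} (ht : t ∈ Icc (0 : ℝ) T) : f t = f 0 + ∫ τ in (0 : ℝ)..t, f' τ := by
  have hc : ContinuousOn f (Icc 0 T) := fun x hx => (h x hx).continuousWithinAt
  rw [intervalIntegral.integral_eq_sub_of_hasDerivAt_of_le ht.1
    (hc.mono (Icc_subset_Icc_right ht.2)) (fun x hx => ?_) (hf'.intervalIntegrable _ _)]
  · ring
  · exact (h x ⟨hx.1.le, hx.2.le.trans ht.2⟩).hasDerivAt
      (Icc_mem_nhds hx.1 (hx.2.trans_le ht.2))

theorem hasDerivWithinAt_of_eq_add_integral {T : ℝ} {f f' : ℝ → ℝ}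
    (h : ∀ t ∈ Icc (0 : ℝ) T, f t = f 0 + ∫ τ in (0 : ℝ)..t, f' τ) (hf' : Continuous f')
    {t : ℝ} (ht : t ∈ Icc (0 : ℝ) T) : HasDerivWithinAt f (f' t) (Icc 0 T) t := by
  have h1 : HasDerivAt (fun t => f 0 + ∫ τ in (0 : ℝ)..t, f' τ) (f' t) t :=
    (intervalIntegral.integral_hasDerivAt_right (hf'.intervalIntegrable _ _)
      (hf'.stronglyMeasurableAtFilter _ _) hf'.continuousAt).const_add _
  exact h1.hasDerivWithinAt.congr h (h t ht)

/-! ### Cutting off smooth integrable functions -/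

/-- A smooth cutoff at scale `n + 1`. -/
noncomputable def cutoff (n : ℕ) (x : ℝ) : ℝ :=
  (⟨1, 2, one_pos, one_lt_two⟩ : ContDiffBump (0 : ℝ)) (((n : ℝ) + 1)⁻¹ * x)

theorem contDiff_cutoff (n : ℕ) : ContDiff ℝ ∞ (cutoff n) :=
  (ContDiffBump.contDiff _).comp (contDiff_const.mul contDiff_id)

theorem hasCompactSupport_cutoff (n : ℕ) : HasCompactSupport (cutoff n) := by
  have h := (⟨1, 2, one_pos, one_lt_two⟩ : ContDiffBump (0 : ℝ)).hasCompactSupport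
  exact h.comp_homeomorph (Homeomorph.mulLeft₀ (((n : ℝ) + 1)⁻¹) (by positivity))

theorem cutoff_eventuallyEq_one {n : ℕ} {x : ℝ} (hx : |x| < n + 1) :
    cutoff n =ᶠ[𝓝 x] fun _ => 1 := by
  have : ∀ᶠ y : ℝ in 𝓝 x, |y| < (n : ℝ) + 1 := continuous_abs.continuousAt.eventually_lt_const hx
  filter_upwards [this] with y hy
  apply ContDiffBump.one_of_mem_closedBall
  simp only [mem_closedBall_zero_iff, norm_mul, Real.norm_eq_abs, abs_inv]
  rw [abs_of_nonneg (by positivity : (0 : ℝ) ≤ n + 1), inv_mul_le_iff₀ (by positivity)]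
  linarith

theorem deriv_cutoff (n : ℕ) (x : ℝ) : deriv (cutoff n) x = ((n : ℝ) + 1)⁻¹ *
    deriv (⟨1, 2, one_pos, one_lt_two⟩ : ContDiffBump (0 : ℝ)) (((n : ℝ) + 1)⁻¹ * x) :=
  deriv_comp_mul_left _ _ _

theorem exists_bound_cutoff : ∃ C : ℝ, 0 ≤ C ∧ ∀ n x, |cutoff n x| ≤ C ∧
    |deriv (cutoff n) x| ≤ C ∧ |deriv (deriv (cutoff n)) x| ≤ C := by
  set B := (⟨1, 2, one_pos, one_lt_two⟩ : ContDiffBump (0 : ℝ)) with hB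
  have hT : IsTest B := ⟨B.contDiff, B.hasCompactSupport⟩
  obtain ⟨C0, h0⟩ := hT.2.exists_bound_of_continuous hT.continuous
  obtain ⟨C1, h1⟩ := hT.isTest_deriv.2.exists_bound_of_continuous hT.isTest_deriv.continuous
  obtain ⟨C2, h2⟩ := hT.isTest_deriv.isTest_deriv.2.exists_bound_of_continuous
    hT.isTest_deriv.isTest_deriv.continuous
  have p0 := (norm_nonneg _).trans (h0 0)
  have p1 := (norm_nonneg _).trans (h1 0)
  have p2 := (norm_nonneg _).trans (h2 0)
  refine ⟨C0 + C1 + C2, by positivity, fun n x => ?_⟩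
  set c : ℝ := ((n : ℝ) + 1)⁻¹ with hc
  have hc0 : 0 ≤ c := by positivity
  have hc1 : c ≤ 1 := inv_le_one_of_one_le₀ (by linarith [(n.cast_nonneg : (0 : ℝ) ≤ n)])
  refine ⟨?_, ?_, ?_⟩
  · have := h0 (c * x)
    rw [Real.norm_eq_abs] at this
    change |B (c * x)| ≤ _
    linarith
  · rw [deriv_cutoff, abs_mul, abs_of_nonneg hc0]
    have := mul_le_mul hc1 (h1 (c * x)) (norm_nonneg _) zero_le_one
    rw [Real.norm_eq_abs] at this
    linarith
  · have e : deriv (cutoff n) = fun x => c * deriv B (c * x) := funext (deriv_cutoff n)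
    rw [e, deriv_const_mul_field, deriv_comp_mul_left, smul_eq_mul, ← mul_assoc, abs_mul,
      abs_of_nonneg (by positivity)]
    have := mul_le_mul (mul_le_one₀ hc1 hc0 hc1) (h2 (c * x)) (norm_nonneg _) zero_le_one
    rw [Real.norm_eq_abs] at this
    linarith

theorem tendsto_integral_abs_sub_of_dominated {g : ℕ → ℝ → ℝ} {g₀ H : ℝ → ℝ}
    (hg : ∀ n, Continuous (g n)) (hg₀ : Integrable g₀) (hH : Integrable H)
    (hb : ∀ n x, |g n x| ≤ H x) (hlim : ∀ x, ∀ᶠ n in atTop, g n x = g₀ x) :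
    Tendsto (fun n => ∫ x, |g n x - g₀ x|) atTop (𝓝 0) := by
  have : Tendsto (fun n => ∫ x, |g n x - g₀ x|) atTop (𝓝 (∫ _ : ℝ, (0 : ℝ))) := by
    refine tendsto_integral_of_dominated_convergence (fun x => H x + |g₀ x|) (fun n => ?_)
      (hH.add hg₀.abs) (fun n => Eventually.of_forall fun x => ?_)
      (Eventually.of_forall fun x => ?_)
    · exact ((hg n).aestronglyMeasurable.sub hg₀.aestronglyMeasurable).norm
    · rw [Real.norm_eq_abs, abs_abs]
      exact (abs_sub _ _).trans (add_le_add (hb n x) le_rfl)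
    · refine tendsto_const_nhds.congr' ?_
      filter_upwards [hlim x] with n hn
      simp [hn]
  simpa using this

/-- Multiplication by cutoffs whose derivatives are bounded uniformly in the scale: near each point
the product eventually equals `ψ`, and Leibniz' rule gives an integrable majorant. Convergence in
`L¹` up to two derivatives suffices, since the pairings are with bounded functions. -/
theorem exists_isTest_approx {ψ : ℝ → ℝ} (hψ : ContDiff ℝ ∞ ψ) (i0 : Integrable ψ)
    (i1 : Integrable (deriv ψ)) (i2 : Integrable (deriv (deriv ψ))) :
    ∃ ψn : ℕ → ℝ → ℝ, (∀ n, IsTest (ψn n)) ∧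
      Tendsto (fun n => ∫ x, |ψn n x - ψ x|) atTop (𝓝 0) ∧
      Tendsto (fun n => ∫ x, |deriv (ψn n) x - deriv ψ x|) atTop (𝓝 0) ∧
      Tendsto (fun n => ∫ x, |deriv (deriv (ψn n)) x - deriv (deriv ψ) x|) atTop (𝓝 0) := by
  obtain ⟨C, hC, hb⟩ := exists_bound_cutoff
  have hT : ∀ n, IsTest fun x => cutoff n x * ψ x := fun n =>
    ⟨(contDiff_cutoff n).mul hψ, (hasCompactSupport_cutoff n).mul_right⟩
  have hψd : ∀ x, HasDerivAt ψ (deriv ψ x) x := fun x =>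
    (hψ.differentiable (by simp) x).hasDerivAt
  have hψ' : ContDiff ℝ ∞ (deriv ψ) := hψ.deriv'
  have hψd' : ∀ x, HasDerivAt (deriv ψ) (deriv (deriv ψ) x) x := fun x =>
    (hψ'.differentiable (by simp) x).hasDerivAt
  have hcT : ∀ n, IsTest (cutoff n) := fun n => ⟨contDiff_cutoff n, hasCompactSupport_cutoff n⟩
  have e1 : ∀ n, deriv (fun x => cutoff n x * ψ x)
      = fun x => deriv (cutoff n) x * ψ x + cutoff n x * deriv ψ x := fun n =>
    funext fun x => (((hcT n).hasDerivAt x).mul (hψd x)).deriv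
  have e2 : ∀ n x, deriv (deriv (fun x => cutoff n x * ψ x)) x
      = (deriv (deriv (cutoff n)) x * ψ x + deriv (cutoff n) x * deriv ψ x)
        + (deriv (cutoff n) x * deriv ψ x + cutoff n x * deriv (deriv ψ) x) := fun n x => by
    rw [e1 n]
    exact ((((hcT n).isTest_deriv.hasDerivAt x).mul (hψd x)).add
      (((hcT n).hasDerivAt x).mul (hψd' x))).deriv
  have hev : ∀ x : ℝ, ∀ᶠ n : ℕ in atTop, (fun x => cutoff n x * ψ x) =ᶠ[𝓝 x] ψ := by
    intro x
    obtain ⟨N, hN⟩ := exists_nat_gt |x|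
    filter_upwards [eventually_ge_atTop N] with n hn
    have hx : |x| < (n : ℝ) + 1 := by
      have : (N : ℝ) ≤ n := by exact_mod_cast hn
      linarith
    filter_upwards [cutoff_eventuallyEq_one hx] with y hy
    rw [hy, one_mul]
  have m : ∀ a c : ℝ, |a| ≤ C → |a * c| ≤ C * |c| := fun a c ha => by
    rw [abs_mul]
    exact mul_le_mul_of_nonneg_right ha (abs_nonneg _)
  refine ⟨fun n x => cutoff n x * ψ x, hT, ?_, ?_, ?_⟩
  · refine tendsto_integral_abs_sub_of_dominated (H := fun x => C * |ψ x|)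
      (fun n => (hT n).continuous) i0 (i0.abs.const_mul C) (fun n x => ?_) fun x => ?_
    · exact m _ _ (hb n x).1
    · filter_upwards [hev x] with n hn using hn.eq_of_nhds
  · refine tendsto_integral_abs_sub_of_dominated (H := fun x => C * |ψ x| + C * |deriv ψ x|)
      (fun n => (hT n).isTest_deriv.continuous) i1
      ((i0.abs.const_mul C).add (i1.abs.const_mul C)) (fun n x => ?_) fun x => ?_
    · rw [e1 n]
      exact (abs_add_le _ _).trans (add_le_add (m _ _ (hb n x).2.1) (m _ _ (hb n x).1))
    · filter_upwards [hev x] with n hn using hn.deriv_eq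
  · refine tendsto_integral_abs_sub_of_dominated
      (H := fun x => (C * |ψ x| + C * |deriv ψ x|) + (C * |deriv ψ x| + C * |deriv (deriv ψ) x|))
      (fun n => (hT n).isTest_deriv.isTest_deriv.continuous) i2
      (((i0.abs.const_mul C).add (i1.abs.const_mul C)).add
        ((i1.abs.const_mul C).add (i2.abs.const_mul C))) (fun n x => ?_) fun x => ?_
    · rw [e2 n]
      exact (abs_add_le _ _).trans (add_le_add
        ((abs_add_le _ _).trans (add_le_add (m _ _ (hb n x).2.2) (m _ _ (hb n x).2.1)))
        ((abs_add_le _ _).trans (add_le_add (m _ _ (hb n x).2.1) (m _ _ (hb n x).1))))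
    · filter_upwards [hev x] with n hn using hn.deriv.deriv_eq

/-! ### Passing to the limit in the test function -/

/-- Integration against an integrable function, on bounded continuous functions. -/
noncomputable def pairing (g : ℝ → ℝ) (hg : Integrable g) : (ℝ →ᵇ ℝ) →L[ℝ] ℝ where
  toFun f := ∫ x, f x * g x
  map_add' a b := by
    rw [← integral_add (integrable_bcf_mul a hg) (integrable_bcf_mul b hg)]
    simp [add_mul]
  map_smul' c a := by
    rw [RingHom.id_apply, smul_eq_mul, ← integral_const_mul]
    simp [mul_assoc]
  cont := continuous_integral_bcf_mul hg

theorem pairing_apply (g : ℝ → ℝ) (hg : Integrable g) (f : ℝ →ᵇ ℝ) :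
    pairing g hg f = ∫ x, f x * g x := rfl

theorem abs_pairing_sub_le {g h : ℝ → ℝ} (hg : Integrable g) (hh : Integrable h) (f : ℝ →ᵇ ℝ) :
    |pairing g hg f - pairing h hh f| ≤ ‖f‖ * ∫ x, |g x - h x| := by
  rw [pairing_apply, pairing_apply, ← integral_sub (integrable_bcf_mul f hg)
    (integrable_bcf_mul f hh)]
  have := abs_integral_bcf_mul_le f (hg.sub hh)
  simpa [mul_sub] using this

theorem tendsto_pairing {gn : ℕ → ℝ → ℝ} {g : ℝ → ℝ} (hgn : ∀ n, Integrable (gn n))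
    (hg : Integrable g) (h : Tendsto (fun n => ∫ x, |gn n x - g x|) atTop (𝓝 0)) (f : ℝ →ᵇ ℝ) :
    Tendsto (fun n => pairing (gn n) (hgn n) f) atTop (𝓝 (pairing g hg f)) := by
  rw [tendsto_iff_norm_sub_tendsto_zero]
  refine squeeze_zero (fun n => norm_nonneg _) (fun n => abs_pairing_sub_le (hgn n) hg f) ?_
  simpa using h.const_mul ‖f‖

/-- `‖f τ‖` is bounded on the compact time interval, so the pairings converge uniformly in `τ`. -/
theorem tendsto_integral_pairing {gn : ℕ → ℝ → ℝ} {g : ℝ → ℝ} (hgn : ∀ n, Integrable (gn n))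
    (hg : Integrable g) (h : Tendsto (fun n => ∫ x, |gn n x - g x|) atTop (𝓝 0))
    {f : ℝ → ℝ →ᵇ ℝ} (hf : Continuous f) (a c : ℝ) :
    Tendsto (fun n => ∫ τ in a..c, pairing (gn n) (hgn n) (f τ)) atTop
      (𝓝 (∫ τ in a..c, pairing g hg (f τ))) := by
  rw [tendsto_iff_norm_sub_tendsto_zero]
  obtain ⟨M, hM⟩ := (isCompact_uIcc (a := a) (b := c)).exists_bound_of_continuousOn hf.continuousOn
  refine squeeze_zero (fun n => norm_nonneg _) (g := fun n => (M * ∫ x, |gn n x - g x|) * |c - a|)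
    (fun n => ?_) ?_
  · have hc1 : Continuous fun τ => pairing (gn n) (hgn n) (f τ) := by fun_prop
    have hc2 : Continuous fun τ => pairing g hg (f τ) := by fun_prop
    rw [← intervalIntegral.integral_sub (hc1.intervalIntegrable _ _) (hc2.intervalIntegrable _ _)]
    refine intervalIntegral.norm_integral_le_of_norm_le_const fun τ hτ => ?_
    refine (abs_pairing_sub_le (hgn n) hg (f τ)).trans ?_
    exact mul_le_mul_of_nonneg_right (hM τ (uIoc_subset_uIcc hτ)) (by positivity)
  · simpa using (h.const_mul M).mul_const |c - a|

end BSystem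

namespace BSystem

open Filter Topology
open scoped BoundedContinuousFunction Convolution

/-! ### The nonlocal transport form of the system -/

/-- `f_t + (U f)_x = S` weakly on `[0,T]`. -/
def WeakTransport (T : ℝ) (U f S : ℝ → ℝ →ᵇ ℝ) : Prop :=
  ∀ χ : ℝ → ℝ, IsTest χ → ∀ t ∈ Icc (0 : ℝ) T,
    HasDerivWithinAt (fun τ => ∫ x, f τ x * χ x)
      ((∫ x, U t x * f t x * deriv χ x) + ∫ x, S t x * χ x) (Icc 0 T) t

/-- The nonlocal source of the system, to which `-∂ₓ(1 - ∂ₓ²)⁻¹` is applied in the equation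
for `u`. -/
noncomputable def source (α b κ : ℝ) (U V R : ℝ →ᵇ ℝ) : ℝ →ᵇ ℝ :=
  (-α) • U + (b / 2) • (U * U) + ((3 - b) / 2) • (V * V) + (κ / 2) • (R * R)

/-- Convolution with the kernel of `(1 - ∂ₓ²)⁻¹`. -/
noncomputable abbrev greenConv : (ℝ →ᵇ ℝ) → (ℝ →ᵇ ℝ) := kconvBCF green integrable_green

/-- Convolution with the derivative of the kernel of `(1 - ∂ₓ²)⁻¹`. -/
noncomputable abbrev greenDerivConv : (ℝ →ᵇ ℝ) → (ℝ →ᵇ ℝ) :=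
  kconvBCF greenDeriv integrable_greenDeriv

theorem continuous_source (α b κ : ℝ) {U V R : ℝ → ℝ →ᵇ ℝ} (hU : Continuous U)
    (hV : Continuous V) (hR : Continuous R) :
    Continuous fun t => source α b κ (U t) (V t) (R t) := by
  unfold source
  fun_prop

section

variable {α b κ s T : ℝ} {u₀ ρ₀ : ℝ → ℝ} {u ux ρ : ℝ → ℝ → ℝ} {U V R : ℝ → ℝ →ᵇ ℝ}

theorem hasDerivAt_sq (hd : ∀ t x, HasDerivAt (U t) (V t x) x) (t x : ℝ) :
    HasDerivAt (fun x => U t x * U t x) (2 * (U t x * V t x)) x := by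
  convert! (hd t x).mul (hd t x) using 1
  ring

/-- `U V = (U²)_x / 2`. Compact support of `ψ` is not required because the identity is also used
with `ψ = G * χ`. -/
theorem integral_UV_mul_eq (hd : ∀ t x, HasDerivAt (U t) (V t x) x) (t : ℝ) {ψ : ℝ → ℝ}
    (hψ : ∀ x, HasDerivAt ψ (deriv ψ x) x) (i0 : Integrable ψ) (i1 : Integrable (deriv ψ)) :
    ∫ x, (U t * V t) x * ψ x = -(1 / 2) * ∫ x, (U t * U t) x * deriv ψ x := by
  have := integral_mul_deriv_eq_deriv_mul_of_integrable
    (fun x _ => hasDerivAt_sq hd t x) (fun x _ => hψ x)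
    (integrable_bcf_mul (U t * U t) i1)
    (by simpa [mul_assoc, Pi.mul_def] using (integrable_bcf_mul (U t * V t) i0).const_mul 2)
    (integrable_bcf_mul (U t * U t) i0)
  have e : ∫ x, 2 * (U t x * V t x) * ψ x = 2 * ∫ x, (U t * V t) x * ψ x := by
    rw [← integral_const_mul]
    congr 1
    ext x
    simp only [BoundedContinuousFunction.coe_mul, Pi.mul_apply]
    ring
  rw [e] at this
  simp only [BoundedContinuousFunction.coe_mul, Pi.mul_apply] at this ⊢
  linarith

/-- The momentum equation tested with a test function. -/
theorem IsSolution.hasDerivWithinAt_momentum (h : IsSolution α b κ s T u₀ ρ₀ u ux ρ)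
    (hd : ∀ t x, HasDerivAt (U t) (V t x) x)
    (hae : ∀ t ∈ Icc (0 : ℝ) T, u t =ᵐ[volume] U t ∧ ux t =ᵐ[volume] V t ∧ ρ t =ᵐ[volume] R t)
    {ψ : ℝ → ℝ} (hψ : IsTest ψ) {t : ℝ} (ht : t ∈ Icc (0 : ℝ) T) :
    HasDerivWithinAt
      (fun τ => pairing ψ hψ.integrable (U τ)
        - pairing _ hψ.isTest_deriv.isTest_deriv.integrable (U τ))
      (pairing _ hψ.isTest_deriv.isTest_deriv.integrable (U t * V t)
        + pairing _ hψ.isTest_deriv.integrable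
          (source α b κ (U t) (V t) (R t) + (1 / 2 : ℝ) • (U t * U t))) (Icc 0 T) t := by
  have i0 := hψ.integrable
  have i1 := hψ.isTest_deriv.integrable
  have i2 := hψ.isTest_deriv.isTest_deriv.integrable
  have e2 : iteratedDeriv 2 ψ = deriv (deriv ψ) := by
    rw [iteratedDeriv_succ, iteratedDeriv_one]
  have key := h.eq_m ψ hψ t ht
  obtain ⟨hu, hux, hρ⟩ := hae t ht
  have a1 : ∫ x, ux t x * ψ x = -pairing _ i1 (U t) := by
    rw [pairing_apply, hψ.integral_mul_deriv (hd t) (V t).continuous, neg_neg]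
    exact integral_congr_ae (by filter_upwards [hux] with x hx; rw [hx])
  have a2 : ∫ x, u t x * ux t x * ψ x = -(1 / 2) * pairing _ i1 (U t * U t) := by
    rw [pairing_apply, ← integral_UV_mul_eq hd t hψ.hasDerivAt i0 i1]
    exact integral_congr_ae (by filter_upwards [hu, hux] with x hx hx'; rw [hx, hx']; rfl)
  have a3 : ∫ x, ux t x ^ 2 * deriv ψ x = pairing _ i1 (V t * V t) :=
    integral_congr_ae (by filter_upwards [hux] with x hx; rw [hx, sq]; rfl)
  have a4 : ∫ x, (u t x ^ 2 + ux t x ^ 2) * deriv ψ x = pairing _ i1 (U t * U t + V t * V t) :=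
    integral_congr_ae (by filter_upwards [hu, hux] with x hx hx'; rw [hx, hx', sq, sq]; rfl)
  have a5 : ∫ x, u t x * ux t x * deriv (deriv ψ) x = pairing _ i2 (U t * V t) :=
    integral_congr_ae (by filter_upwards [hu, hux] with x hx hx'; rw [hx, hx']; rfl)
  have a6 : ∫ x, ρ t x ^ 2 * deriv ψ x = pairing _ i1 (R t * R t) :=
    integral_congr_ae (by filter_upwards [hρ] with x hx; rw [hx, sq]; rfl)
  have e : ∀ τ ∈ Icc (0 : ℝ) T, pairing _ i0 (U τ) - pairing _ i2 (U τ) = pairM (u τ) ψ := by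
    intro τ hτ
    rw [pairing_apply, pairing_apply, ← integral_sub (integrable_bcf_mul _ i0)
      (integrable_bcf_mul _ i2), pairM, e2]
    exact integral_congr_ae (by filter_upwards [(hae τ hτ).1] with x hx; rw [hx]; ring)
  -- Against `ψ'`, `U²` collects `b/2 + 1 - 1/2` and `V²` collects `-b/2 + 1 + 1/2`. This is
  -- `source` plus a surplus `U²/2`, which disappears once `ψ'' = ψ - χ` is inserted.
  refine (key.congr e (e t ht)).congr_deriv ?_
  simp only [pairUMx, pairUM, pairUxM, pairRhoRhox, a1, a2, a3, a4, a5, a6, source, map_add,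
    map_smul, smul_eq_mul]
  ring

theorem continuous_pairing_comp {g : ℝ → ℝ} (hg : Integrable g) {f : ℝ → ℝ →ᵇ ℝ}
    (hf : Continuous f) : Continuous fun t => pairing g hg (f t) :=
  (pairing g hg).continuous.comp hf

/-- The momentum equation tested with `(1 - ∂ₓ²)⁻¹ χ`. -/
theorem IsSolution.hasDerivWithinAt_velocity (h : IsSolution α b κ s T u₀ ρ₀ u ux ρ)
    (hU : Continuous U) (hV : Continuous V) (hR : Continuous R)
    (hd : ∀ t x, HasDerivAt (U t) (V t x) x)
    (hae : ∀ t ∈ Icc (0 : ℝ) T, u t =ᵐ[volume] U t ∧ ux t =ᵐ[volume] V t ∧ ρ t =ᵐ[volume] R t)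
    {χ : ℝ → ℝ} (hχ : IsTest χ) {t : ℝ} (ht : t ∈ Icc (0 : ℝ) T) :
    HasDerivWithinAt (fun τ => pairing χ hχ.integrable (U τ))
      (-pairing χ hχ.integrable (U t * V t)
        + pairing _ (hχ.integrable_kconv integrable_greenDeriv)
          (source α b κ (U t) (V t) (R t))) (Icc 0 T) t := by
  -- With this choice `ψ - ψ'' = χ`, so pairing `m` with `ψ` is pairing `u` with `χ`. Since `ψ` need
  -- not have compact support, the equation is reached through cutoffs.
  set ψ := kconv green χ with hψdef
  have hψ : ContDiff ℝ ∞ ψ := hχ.contDiff_kconv integrable_green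
  have d1 : deriv ψ = kconv greenDeriv χ := funext fun x => by
    rw [(hχ.hasDerivAt_kconv integrable_green x).deriv, hχ.kconv_green_deriv]
  have d2 : deriv (deriv ψ) = fun x => ψ x - χ x := funext fun x => by
    rw [d1, (hχ.hasDerivAt_kconv integrable_greenDeriv x).deriv, hχ.kconv_greenDeriv_deriv]
  have i0 : Integrable ψ := hχ.integrable_kconv integrable_green
  have i1 : Integrable (deriv ψ) := by
    rw [d1]; exact hχ.integrable_kconv integrable_greenDeriv
  have i2 : Integrable (deriv (deriv ψ)) := by
    rw [d2]; exact i0.sub hχ.integrable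
  obtain ⟨ψn, hT, t0, t1, t2⟩ := exists_isTest_approx hψ i0 i1 i2
  set G : ℝ → ℝ →ᵇ ℝ := fun t => source α b κ (U t) (V t) (R t) + (1 / 2 : ℝ) • (U t * U t) with hG
  have hGc : Continuous G := (continuous_source α b κ hU hV hR).add (by fun_prop)
  have hUV : Continuous fun t => U t * V t := by fun_prop
  have hcn : ∀ n, Continuous fun t =>
      pairing _ (hT n).isTest_deriv.isTest_deriv.integrable (U t * V t)
        + pairing _ (hT n).isTest_deriv.integrable (G t) := fun n =>
    (continuous_pairing_comp _ hUV).add (continuous_pairing_comp _ hGc)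
  have hc : Continuous fun t => pairing _ i2 (U t * V t) + pairing _ i1 (G t) :=
    (continuous_pairing_comp _ hUV).add (continuous_pairing_comp _ hGc)
  have hint : ∀ t ∈ Icc (0 : ℝ) T, pairing ψ i0 (U t) - pairing _ i2 (U t)
      = (pairing ψ i0 (U 0) - pairing _ i2 (U 0))
        + ∫ τ in (0 : ℝ)..t, (pairing _ i2 (U τ * V τ) + pairing _ i1 (G τ)) := by
    intro t ht
    have hn : ∀ n, pairing _ (hT n).integrable (U t)
          - pairing _ (hT n).isTest_deriv.isTest_deriv.integrable (U t)
        = (pairing _ (hT n).integrable (U 0)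
          - pairing _ (hT n).isTest_deriv.isTest_deriv.integrable (U 0))
        + ∫ τ in (0 : ℝ)..t, (pairing _ (hT n).isTest_deriv.isTest_deriv.integrable (U τ * V τ)
          + pairing _ (hT n).isTest_deriv.integrable (G τ)) := fun n =>
      eq_add_integral_of_hasDerivWithinAt
        (fun t ht => h.hasDerivWithinAt_momentum hd hae (hT n) ht) (hcn n) ht
    have l1 := (tendsto_pairing (fun n => (hT n).integrable) i0 t0 (U t)).sub
      (tendsto_pairing (fun n => (hT n).isTest_deriv.isTest_deriv.integrable) i2 t2 (U t))
    have l2 := (tendsto_pairing (fun n => (hT n).integrable) i0 t0 (U 0)).sub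
      (tendsto_pairing (fun n => (hT n).isTest_deriv.isTest_deriv.integrable) i2 t2 (U 0))
    have l3 := (tendsto_integral_pairing
        (fun n => (hT n).isTest_deriv.isTest_deriv.integrable) i2 t2 hUV 0 t).add
      (tendsto_integral_pairing (fun n => (hT n).isTest_deriv.integrable) i1 t1 hGc 0 t)
    refine tendsto_nhds_unique l1 (((l2.add l3).congr fun n => ?_).trans_eq ?_)
    · rw [hn n, intervalIntegral.integral_add
        ((continuous_pairing_comp _ hUV).intervalIntegrable _ _)
        ((continuous_pairing_comp _ hGc).intervalIntegrable _ _)]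
    · rw [intervalIntegral.integral_add
        ((continuous_pairing_comp _ hUV).intervalIntegrable _ _)
        ((continuous_pairing_comp _ hGc).intervalIntegrable _ _)]
  have e0 : ∀ f : ℝ →ᵇ ℝ, pairing _ i2 f = pairing ψ i0 f - pairing χ hχ.integrable f := by
    intro f
    simp only [pairing_apply]
    rw [← integral_sub (integrable_bcf_mul _ i0) (integrable_bcf_mul _ hχ.integrable), d2]
    simp only [mul_sub]
  have e1 : pairing _ i1 (source α b κ (U t) (V t) (R t))
      = pairing _ (hχ.integrable_kconv integrable_greenDeriv) (source α b κ (U t) (V t) (R t)) := by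
    simp only [pairing_apply, d1]
  have hfin := hasDerivWithinAt_of_eq_add_integral hint hc ht
  simp only [e0, sub_sub_cancel] at hfin
  refine hfin.congr_deriv ?_
  -- The part `∫ U V ψ` of `∫ U V ψ''` cancels the surplus `(1/2) ∫ U² ψ'`.
  have e3 := integral_UV_mul_eq hd t (fun x => (hψ.differentiable (by simp) x).hasDerivAt) i0 i1
  rw [← e1]
  simp only [hG, map_add, map_smul, smul_eq_mul]
  simp only [← pairing_apply _ i0, ← pairing_apply _ i1] at e3
  rw [e3]
  ring

/-- The term `-u u_x` is written as `-(u²)_x + u u_x`, so that all three unknowns satisfy equations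
of the same conservative form. -/
theorem IsSolution.weakTransport_velocity (h : IsSolution α b κ s T u₀ ρ₀ u ux ρ)
    (hU : Continuous U) (hV : Continuous V) (hR : Continuous R)
    (hd : ∀ t x, HasDerivAt (U t) (V t x) x)
    (hae : ∀ t ∈ Icc (0 : ℝ) T, u t =ᵐ[volume] U t ∧ ux t =ᵐ[volume] V t ∧ ρ t =ᵐ[volume] R t) :
    WeakTransport T U U
      fun t => U t * V t - greenDerivConv (source α b κ (U t) (V t) (R t)) := by
  intro χ hχ t ht
  refine (h.hasDerivWithinAt_velocity hU hV hR hd hae hχ ht).congr_deriv ?_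
  rw [pairing_apply _ (hχ.integrable_kconv integrable_greenDeriv),
    integral_mul_kconv_greenDeriv hχ.integrable]
  have e3 := integral_UV_mul_eq hd t hχ.hasDerivAt hχ.integrable hχ.isTest_deriv.integrable
  have e4 : ∫ x, U t x * U t x * deriv χ x = ∫ x, (U t * U t) x * deriv χ x := rfl
  rw [← pairing_apply _ hχ.integrable, ← pairing_apply _ hχ.integrable, map_sub, e4]
  rw [← pairing_apply _ hχ.integrable] at e3
  linarith

/-- The velocity equation tested with `χ'`, together with `G'' = G - δ`; no second derivative of `u`
appears. -/
theorem IsSolution.weakTransport_slope (h : IsSolution α b κ s T u₀ ρ₀ u ux ρ)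
    (hU : Continuous U) (hV : Continuous V) (hR : Continuous R)
    (hd : ∀ t x, HasDerivAt (U t) (V t x) x)
    (hae : ∀ t ∈ Icc (0 : ℝ) T, u t =ᵐ[volume] U t ∧ ux t =ᵐ[volume] V t ∧ ρ t =ᵐ[volume] R t) :
    WeakTransport T U V fun t =>
      source α b κ (U t) (V t) (R t) - greenConv (source α b κ (U t) (V t) (R t)) := by
  intro χ hχ t ht
  have e : ∀ τ, ∫ x, V τ x * χ x = -pairing _ hχ.isTest_deriv.integrable (U τ) := fun τ => by
    rw [pairing_apply, hχ.integral_mul_deriv (hd τ) (V τ).continuous, neg_neg]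
  simp only [e]
  refine (h.hasDerivWithinAt_velocity hU hV hR hd hae hχ.isTest_deriv ht).neg.congr_deriv ?_
  set F := source α b κ (U t) (V t) (R t)
  have e1 : pairing _ (hχ.isTest_deriv.integrable_kconv integrable_greenDeriv) F
      = pairing χ hχ.integrable (greenConv F) - pairing χ hχ.integrable F := by
    simp only [pairing_apply]
    rw [← integral_mul_kconv_green hχ.integrable, ← integral_sub
      (integrable_bcf_mul _ (hχ.integrable_kconv integrable_green))
      (integrable_bcf_mul _ hχ.integrable)]
    congr 1
    ext x
    rw [hχ.kconv_greenDeriv_deriv]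
    ring
  have e4 : ∫ x, U t x * V t x * deriv χ x
      = pairing _ hχ.isTest_deriv.integrable (U t * V t) := rfl
  rw [e1, e4, ← pairing_apply _ hχ.integrable, map_sub]
  ring

theorem IsSolution.weakTransport_density (h : IsSolution α b κ s T u₀ ρ₀ u ux ρ)
    (hae : ∀ t ∈ Icc (0 : ℝ) T, u t =ᵐ[volume] U t ∧ ux t =ᵐ[volume] V t ∧ ρ t =ᵐ[volume] R t) :
    WeakTransport T U R fun t => (2 - b) • (V t * R t) := by
  intro χ hχ t ht
  obtain ⟨hu, hux, hρ⟩ := hae t ht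
  have e : ∀ τ ∈ Icc (0 : ℝ) T, ∫ x, R τ x * χ x = ∫ x, ρ τ x * χ x := fun τ hτ =>
    integral_congr_ae (by filter_upwards [(hae τ hτ).2.2] with x hx; rw [hx])
  refine ((h.eq_rho χ hχ t ht).congr e (e t ht)).congr_deriv ?_
  have a1 : ∫ x, u t x * ρ t x * deriv χ x = ∫ x, U t x * R t x * deriv χ x :=
    integral_congr_ae (by filter_upwards [hu, hρ] with x hx hx'; rw [hx, hx'])
  have a2 : ∫ x, ux t x * ρ t x * χ x = pairing χ hχ.integrable (V t * R t) :=
    integral_congr_ae (by filter_upwards [hux, hρ] with x hx hx'; rw [hx, hx']; rfl)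
  rw [pairURhox, a1, a2, ← pairing_apply _ hχ.integrable, map_smul, smul_eq_mul]
  ring

end

end BSystem

namespace BSystem

open Filter Topology Asymptotics
open scoped BoundedContinuousFunction Convolution

/-! ### Transport along characteristics -/

theorem continuous_bcf_eval {F : ℝ → ℝ →ᵇ ℝ} (hF : Continuous F) {X : ℝ → ℝ} (hX : Continuous X) :
    Continuous fun t => F t (X t) :=
  hF.eval hX

theorem kconvBCF_eq_integral_sub {k : ℝ → ℝ} (hk : Integrable k) (F : ℝ →ᵇ ℝ) (x : ℝ) :
    kconvBCF k hk F x = ∫ y, F y * k (x - y) := by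
  rw [kconvBCF_apply, ← integral_sub_left_eq_self (fun y => k y * F (x - y)) volume x]
  simp [mul_comm]

theorem kconvBCF_sub {k : ℝ → ℝ} (hk : Integrable k) (F G : ℝ →ᵇ ℝ) :
    kconvBCF k hk (F - G) = kconvBCF k hk F - kconvBCF k hk G := by
  ext x
  simp only [kconvBCF_apply, BoundedContinuousFunction.coe_sub, Pi.sub_apply]
  rw [← integral_sub (integrable_kernel_mul hk F x) (integrable_kernel_mul hk G x)]
  simp [mul_sub]

theorem norm_kconvBCF_le {k : ℝ → ℝ} (hk : Integrable k) (F : ℝ →ᵇ ℝ) :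
    ‖kconvBCF k hk F‖ ≤ (∫ y, |k y|) * ‖F‖ := by
  refine BoundedContinuousFunction.norm_ofNormedAddCommGroup_le _ (by positivity) fun x => ?_
  rw [← integral_mul_const]
  refine norm_integral_le_of_norm_le (hk.abs.mul_const _) (Eventually.of_forall fun y => ?_)
  rw [norm_mul]
  exact mul_le_mul_of_nonneg_left (F.norm_coe_le_norm _) (abs_nonneg _)

theorem IsTest.hasDerivAt_kconvBCF {ζ : ℝ → ℝ} (hζ : IsTest ζ) (F : ℝ →ᵇ ℝ) (x : ℝ) :
    HasDerivAt (kconvBCF ζ hζ.integrable F)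
      (kconvBCF (deriv ζ) hζ.isTest_deriv.integrable F x) x := by
  have h := hζ.2.hasDerivAt_convolution_left (ContinuousLinearMap.mul ℝ ℝ)
    (hζ.1.of_le (by simp)) (F.continuous.locallyIntegrable (μ := volume)) x
  rw [← kconv_eq_convolution, ← kconv_eq_convolution] at h
  exact h

theorem IsTest.abs_kconvBCF_sub_le {ζ : ℝ → ℝ} (hζ : IsTest ζ) (F : ℝ →ᵇ ℝ) (x y : ℝ) :
    |kconvBCF ζ hζ.integrable F x - kconvBCF ζ hζ.integrable F y|
      ≤ ((∫ z, |deriv ζ z|) * ‖F‖) * |x - y| := by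
  have := Convex.norm_image_sub_le_of_norm_hasDerivWithin_le (s := univ) (x := y) (y := x)
    (fun z _ => (hζ.hasDerivAt_kconvBCF F z).hasDerivWithinAt)
    (fun z _ => ((kconvBCF _ hζ.isTest_deriv.integrable F).norm_coe_le_norm z).trans
      (norm_kconvBCF_le _ F)) convex_univ (mem_univ _) (mem_univ _)
  simpa using this

theorem WeakTransport.hasDerivWithinAt_kconvBCF {T : ℝ} {U f S : ℝ → ℝ →ᵇ ℝ}
    (h : WeakTransport T U f S) {ζ : ℝ → ℝ} (hζ : IsTest ζ) (x : ℝ) {t : ℝ}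
    (ht : t ∈ Icc (0 : ℝ) T) :
    HasDerivWithinAt (fun τ => kconvBCF ζ hζ.integrable (f τ) x)
      (kconvBCF ζ hζ.integrable (S t) x
        - kconvBCF _ hζ.isTest_deriv.integrable (U t * f t) x) (Icc 0 T) t := by
  have := h _ (hζ.comp_const_sub x) t ht
  simp only [kconvBCF_eq_integral_sub]
  refine this.congr_deriv ?_
  have e : ∀ y, deriv (fun y => ζ (x - y)) y = -deriv ζ (x - y) := fun y => by
    simp [deriv_comp_const_sub]
  simp only [e, mul_neg, integral_neg, BoundedContinuousFunction.coe_mul, Pi.mul_apply]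
  ring

/-- A chain rule for a function differentiable in time at each fixed point and in space. The
remaining mixed difference is negligible because mollifying `f τ - f t` gives a Lipschitz constant
that tends to zero as `τ → t`. -/
theorem WeakTransport.hasDerivWithinAt_along {T : ℝ} {U f S : ℝ → ℝ →ᵇ ℝ}
    (h : WeakTransport T U f S) (hf : Continuous f) {ζ : ℝ → ℝ} (hζ : IsTest ζ)
    {X : ℝ → ℝ} {s : Set ℝ} (hs : s ⊆ Icc 0 T) {t : ℝ} (ht : t ∈ s)
    (hX : HasDerivWithinAt X (U t (X t)) s t) :
    HasDerivWithinAt (fun τ => kconvBCF ζ hζ.integrable (f τ) (X τ))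
      (U t (X t) * kconvBCF _ hζ.isTest_deriv.integrable (f t) (X t)
        - kconvBCF _ hζ.isTest_deriv.integrable (U t * f t) (X t)
        + kconvBCF ζ hζ.integrable (S t) (X t)) s t := by
  have h1 := (h.hasDerivWithinAt_kconvBCF hζ (X t) (hs ht)).mono hs
  have h2 := (hζ.hasDerivAt_kconvBCF (f t) (X t)).comp_hasDerivWithinAt t hX
  have h3 : HasDerivWithinAt (fun τ => kconvBCF ζ hζ.integrable (f τ - f t) (X τ)
      - kconvBCF ζ hζ.integrable (f τ - f t) (X t)) 0 s t := by
    rw [hasDerivWithinAt_iff_isLittleO]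
    simp only [sub_self, smul_zero, sub_zero]
    have o1 : (fun τ => ‖f τ - f t‖) =o[𝓝[s] t] fun _ => (1 : ℝ) := by
      rw [isLittleO_one_iff]
      have : ContinuousWithinAt (fun τ => ‖f τ - f t‖) s t := by fun_prop
      simpa [ContinuousWithinAt] using this.tendsto
    have o2 : (fun τ => X τ - X t) =O[𝓝[s] t] fun τ => τ - t := hX.hasFDerivWithinAt.isBigO_sub
    refine IsBigO.trans_isLittleO (g := fun τ => ‖f τ - f t‖ * (X τ - X t)) ?_
      (by simpa using o1.mul_isBigO o2)
    refine IsBigO.of_bound (∫ z, |deriv ζ z|) (Eventually.of_forall fun τ => ?_)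
    rw [norm_mul, norm_norm, ← mul_assoc]
    exact hζ.abs_kconvBCF_sub_le _ _ _
  have h4 := ((h1.add h2).add h3).sub_const (kconvBCF ζ hζ.integrable (f t) (X t))
  refine (h4.congr_deriv ?_).congr (fun τ _ => ?_) ?_
  · ring
  · simp only [kconvBCF_sub, BoundedContinuousFunction.coe_sub, Pi.sub_apply, Pi.add_apply,
      Function.comp]
    ring
  · simp only [kconvBCF_sub, BoundedContinuousFunction.coe_sub, Pi.sub_apply, Pi.add_apply,
      Function.comp]
    ring

/-! ### Mollifiers and the commutator limit -/

theorem exists_isTest_integral_eq_one : ∃ η : ℝ → ℝ, IsTest η ∧ ∫ x, η x = 1 := by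
  set B : ContDiffBump (0 : ℝ) := ⟨1, 2, one_pos, one_lt_two⟩
  exact ⟨B.normed volume, ⟨B.contDiff_normed, B.hasCompactSupport_normed⟩, B.integral_normed⟩

/-- The rescaled function `x ↦ c η (c x)`. -/
noncomputable def rescale (c : ℝ) (η : ℝ → ℝ) (x : ℝ) : ℝ := c * η (c * x)

theorem IsTest.rescale {η : ℝ → ℝ} (hη : IsTest η) {c : ℝ} (hc : 0 < c) : IsTest (rescale c η) := by
  refine ⟨contDiff_const.mul (hη.1.comp (contDiff_const.mul contDiff_id)), ?_⟩
  have := hη.2.comp_homeomorph (Homeomorph.mulLeft₀ c hc.ne')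
  exact this.mul_left

theorem deriv_rescale (c : ℝ) (η : ℝ → ℝ) (x : ℝ) :
    deriv (rescale c η) x = c * (c * deriv η (c * x)) := by
  unfold rescale
  rw [deriv_const_mul_field, deriv_comp_mul_left, smul_eq_mul]

theorem integral_rescale_mul {c : ℝ} (hc : 0 < c) (η g : ℝ → ℝ) :
    ∫ z, c * η (c * z) * g z = ∫ z, η z * g (c⁻¹ * z) := by
  have := Measure.integral_comp_mul_left (fun z => η z * g (c⁻¹ * z)) c
  rw [abs_of_pos (inv_pos.2 hc), smul_eq_mul] at this
  rw [← mul_right_inj' (inv_pos.2 hc).ne', ← this, ← integral_const_mul]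
  congr 1
  ext z
  field_simp

theorem tendsto_integral_mul_comp_sub {η : ℝ → ℝ} (hη : Integrable η) (g : ℝ →ᵇ ℝ) (x : ℝ) :
    Tendsto (fun n : ℕ => ∫ z, η z * g (x - ((n : ℝ) + 1)⁻¹ * z)) atTop
      (𝓝 ((∫ z, η z) * g x)) := by
  rw [← integral_mul_const]
  refine tendsto_integral_of_dominated_convergence (fun z => |η z| * ‖g‖) (fun n => ?_)
    (hη.abs.mul_const _) (fun n => Eventually.of_forall fun z => ?_)
    (Eventually.of_forall fun z => ?_)
  · exact hη.aestronglyMeasurable.mul (by fun_prop)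
  · rw [norm_mul]
    exact mul_le_mul_of_nonneg_left (g.norm_coe_le_norm _) (abs_nonneg _)
  · refine Tendsto.const_mul _ ?_
    have : Tendsto (fun n : ℕ => x - ((n : ℝ) + 1)⁻¹ * z) atTop (𝓝 (x - 0 * z)) :=
      tendsto_const_nhds.sub ((tendsto_inv_atTop_zero.comp
        (tendsto_atTop_add_const_right _ _ tendsto_natCast_atTop_atTop)).mul_const z)
    rw [zero_mul, sub_zero] at this
    exact (g.continuous.tendsto x).comp this

theorem IsTest.integral_id_mul_deriv {η : ℝ → ℝ} (hη : IsTest η) :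
    ∫ z, z * deriv η z = -∫ z, η z := by
  have := hη.integral_mul_deriv (F := fun z => z) (G := fun _ => 1) hasDerivAt_id' (by fun_prop)
  simpa using this

/-- The Lipschitz constant `‖V‖` of `U` absorbs the factor `c` produced by differentiating the
mollifier, so the bound is uniform in the scale. -/
theorem abs_commutator_le {U V : ℝ →ᵇ ℝ} (hd : ∀ x, HasDerivAt U (V x) x) (g : ℝ →ᵇ ℝ)
    {c : ℝ} (hc : 0 < c) (w x z : ℝ) :
    |c * (U x - U (x - c⁻¹ * z)) * (w * g (x - c⁻¹ * z))| ≤ ‖V‖ * ‖g‖ * |z * w| := by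
  have hlip := Convex.norm_image_sub_le_of_norm_hasDerivWithin_le (s := univ)
    (x := x - c⁻¹ * z) (y := x) (fun z _ => (hd z).hasDerivWithinAt)
    (fun z _ => V.norm_coe_le_norm z) convex_univ (mem_univ _) (mem_univ _)
  rw [sub_sub_cancel, norm_mul, Real.norm_eq_abs, Real.norm_eq_abs, Real.norm_eq_abs,
    abs_of_pos (inv_pos.2 hc)] at hlip
  have h1 : |c * (U x - U (x - c⁻¹ * z))| ≤ ‖V‖ * |z| := by
    rw [abs_mul, abs_of_pos hc]
    calc c * |U x - U (x - c⁻¹ * z)| ≤ c * (‖V‖ * (c⁻¹ * |z|)) := by gcongr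
      _ = ‖V‖ * |z| := by field_simp
  rw [abs_mul, abs_mul w]
  calc |c * (U x - U (x - c⁻¹ * z))| * (|w| * |g (x - c⁻¹ * z)|)
      ≤ (‖V‖ * |z|) * (|w| * ‖g‖) := by
        gcongr
        exact g.norm_coe_le_norm _
    _ = ‖V‖ * ‖g‖ * |z * w| := by rw [abs_mul]; ring

/-- The difference quotient of `U` tends to `V x * z`, and `∫ z η' = -∫ η`: the commutator of
mollification with transport converges to `-V g` when `η` has mass one. -/
theorem tendsto_commutator {η : ℝ → ℝ} (hη : IsTest η) {U V : ℝ →ᵇ ℝ}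
    (hd : ∀ x, HasDerivAt U (V x) x) (g : ℝ →ᵇ ℝ) (x : ℝ) :
    Tendsto (fun n : ℕ => ∫ z, ((n : ℝ) + 1) * (U x - U (x - ((n : ℝ) + 1)⁻¹ * z)) *
      (deriv η z * g (x - ((n : ℝ) + 1)⁻¹ * z))) atTop (𝓝 (-(∫ z, η z) * (V x * g x))) := by
  have e : -(∫ z, η z) * (V x * g x) = ∫ z, (V x * z) * (deriv η z * g x) := by
    rw [← hη.integral_id_mul_deriv, ← integral_mul_const]
    congr 1
    ext z
    ring
  have hz : Integrable fun z => z * deriv η z := hη.isTest_deriv.integrable_mul (by fun_prop)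
  have hn : Tendsto (fun n : ℕ => ((n : ℝ) + 1)⁻¹) atTop (𝓝 0) :=
    tendsto_inv_atTop_zero.comp
      (tendsto_atTop_add_const_right _ _ tendsto_natCast_atTop_atTop)
  rw [e]
  refine tendsto_integral_of_dominated_convergence
    (fun z => ‖V‖ * ‖g‖ * |z * deriv η z|) (fun n => ?_)
    (hz.abs.const_mul _) (fun n => Eventually.of_forall fun z => ?_)
    (Eventually.of_forall fun z => ?_)
  · have := hη.isTest_deriv.continuous
    exact (by fun_prop : Continuous _).aestronglyMeasurable
  · exact abs_commutator_le hd g (by positivity) _ _ _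
  · refine Tendsto.mul ?_ (Tendsto.const_mul _ ?_)
    · have hd' : HasDerivAt (fun s => U (x - s * z)) (V x * -z) 0 := by
        have hi : HasDerivAt (fun s : ℝ => x - s * z) (-z) 0 := by
          simpa using ((hasDerivAt_id (0 : ℝ)).mul_const z).const_sub x
        have hx : HasDerivAt U (V x) (x - 0 * z) := by simpa using hd x
        exact hx.comp (0 : ℝ) hi
      have hs := hd'.tendsto_slope_zero
      have hn' : Tendsto (fun n : ℕ => ((n : ℝ) + 1)⁻¹) atTop (𝓝[≠] 0) :=
        tendsto_nhdsWithin_iff.2 ⟨hn, Eventually.of_forall fun n => by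
          simp only [mem_compl_iff, mem_singleton_iff]; positivity⟩
      have := (hs.comp hn').neg
      refine (this.congr fun n => ?_).trans_eq (by ring_nf)
      simp only [Function.comp, inv_inv, zero_add, zero_mul, sub_zero, smul_eq_mul]
      ring
    · have : Tendsto (fun n : ℕ => x - ((n : ℝ) + 1)⁻¹ * z) atTop (𝓝 (x - 0 * z)) :=
        tendsto_const_nhds.sub (hn.mul_const z)
      rw [zero_mul, sub_zero] at this
      exact (g.continuous.tendsto x).comp this

end BSystem

namespace BSystem

open Filter Topology Asymptotics
open scoped BoundedContinuousFunction Convolution NNReal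

theorem kconvBCF_commutator {ζ : ℝ → ℝ} (hζ : IsTest ζ) (U f : ℝ →ᵇ ℝ) (x : ℝ) :
    U x * kconvBCF _ hζ.isTest_deriv.integrable f x
      - kconvBCF _ hζ.isTest_deriv.integrable (U * f) x
      = ∫ z, deriv ζ z * ((U x - U (x - z)) * f (x - z)) := by
  rw [kconvBCF_apply, kconvBCF_apply, ← integral_const_mul, ← integral_sub
    ((integrable_kernel_mul hζ.isTest_deriv.integrable f x).const_mul _)
    (integrable_kernel_mul hζ.isTest_deriv.integrable (U * f) x)]
  congr 1
  ext z
  simp only [BoundedContinuousFunction.coe_mul, Pi.mul_apply]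
  ring

/-- A weak solution of `f_t + (U f)_x = S` satisfies `d/dt f(t, X(t)) = S - U_x f` along the
characteristics `X' = U(t, X)`. -/
theorem WeakTransport.along_characteristic {T : ℝ} {U V f S : ℝ → ℝ →ᵇ ℝ}
    (h : WeakTransport T U f S) (hU : Continuous U) (hV : Continuous V) (hf : Continuous f)
    (hS : Continuous S) (hd : ∀ t x, HasDerivAt (U t) (V t x) x) {a c : ℝ} (ha : 0 ≤ a)
    (hac : a ≤ c) (hc : c ≤ T) {X : ℝ → ℝ} (hXc : Continuous X)
    (hX : ∀ t ∈ Icc a c, HasDerivWithinAt X (U t (X t)) (Icc a c) t) :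
    f c (X c) - f a (X a) = ∫ τ in a..c, (S τ (X τ) - V τ (X τ) * f τ (X τ)) := by
  obtain ⟨η, hη, hη1⟩ := exists_isTest_integral_eq_one
  have hp : ∀ n : ℕ, (0 : ℝ) < n + 1 := fun n => by positivity
  set ζ : ℕ → ℝ → ℝ := fun n => rescale ((n : ℝ) + 1) η with hζdef
  have hζ : ∀ n, IsTest (ζ n) := fun n => hη.rescale (hp n)
  have eζ : ∀ (n : ℕ) (g : ℝ →ᵇ ℝ) (x : ℝ), kconvBCF (ζ n) (hζ n).integrable g x
      = ∫ z, η z * g (x - ((n : ℝ) + 1)⁻¹ * z) := fun n g x =>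
    integral_rescale_mul (hp n) η fun z => g (x - z)
  -- The derivative along `X` of the mollified `f`: a commutator plus the mollified source.
  set D : ℕ → ℝ → ℝ := fun n t =>
    (U t (X t) * kconvBCF _ (hζ n).isTest_deriv.integrable (f t) (X t)
      - kconvBCF _ (hζ n).isTest_deriv.integrable (U t * f t) (X t)
      + kconvBCF (ζ n) (hζ n).integrable (S t) (X t)) with hD
  have eD : ∀ n t, D n t
      = (∫ z, ((n : ℝ) + 1) * (U t (X t) - U t (X t - ((n : ℝ) + 1)⁻¹ * z)) *
        (deriv η z * f t (X t - ((n : ℝ) + 1)⁻¹ * z)))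
        + ∫ z, η z * S t (X t - ((n : ℝ) + 1)⁻¹ * z) := by
    intro n t
    simp only [hD]
    rw [kconvBCF_commutator (hζ n), eζ]
    congr 1
    simp only [hζdef, deriv_rescale, mul_assoc]
    have := integral_rescale_mul (hp n) (deriv η)
      (fun z => ((n : ℝ) + 1) * ((U t (X t) - U t (X t - z)) * f t (X t - z)))
    calc _ = ∫ z, ((n : ℝ) + 1) * deriv η (((n : ℝ) + 1) * z) *
          (((n : ℝ) + 1) * ((U t (X t) - U t (X t - z)) * f t (X t - z))) := by
          congr 1; ext z; ring
      _ = _ := by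
          rw [this]
          congr 1; ext z; ring
  have hDc : ∀ n, Continuous (D n) := by
    intro n
    have c1 : Continuous fun t => kconvBCF _ (hζ n).isTest_deriv.integrable (f t) (X t) :=
      continuous_bcf_eval ((continuous_kconvBCF _).comp hf) hXc
    have c2 : Continuous fun t => kconvBCF _ (hζ n).isTest_deriv.integrable (U t * f t) (X t) :=
      continuous_bcf_eval ((continuous_kconvBCF _).comp (hU.mul hf)) hXc
    have c3 : Continuous fun t => kconvBCF (ζ n) (hζ n).integrable (S t) (X t) :=
      continuous_bcf_eval ((continuous_kconvBCF _).comp hS) hXc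
    exact (((continuous_bcf_eval hU hXc).mul c1).sub c2).add c3
  have hFTC : ∀ n, kconvBCF (ζ n) (hζ n).integrable (f c) (X c)
      - kconvBCF (ζ n) (hζ n).integrable (f a) (X a) = ∫ τ in a..c, D n τ := by
    intro n
    have hder : ∀ t ∈ Icc a c, HasDerivWithinAt
        (fun τ => kconvBCF (ζ n) (hζ n).integrable (f τ) (X τ)) (D n t) (Icc a c) t :=
      fun t ht => h.hasDerivWithinAt_along hf (hζ n) (Icc_subset_Icc ha hc) ht (hX t ht)
    rw [intervalIntegral.integral_eq_sub_of_hasDerivAt_of_le hac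
      (fun x hx => (hder x hx).continuousWithinAt)
      (fun x hx => (hder x (Ioo_subset_Icc_self hx)).hasDerivAt (Icc_mem_nhds hx.1 hx.2))
      ((hDc n).intervalIntegrable _ _)]
  have hlim : ∀ (g : ℝ →ᵇ ℝ) (x : ℝ), Tendsto (fun n => kconvBCF (ζ n) (hζ n).integrable g x)
      atTop (𝓝 (g x)) := fun g x => by
    have := tendsto_integral_mul_comp_sub hη.integrable g x
    rw [hη1, one_mul] at this
    exact this.congr fun n => (eζ n g x).symm
  have hzi : Integrable fun z => z * deriv η z := hη.isTest_deriv.integrable_mul (by fun_prop)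
  have hI : Tendsto (fun n => ∫ τ in a..c, D n τ) atTop
      (𝓝 (∫ τ in a..c, (S τ (X τ) - V τ (X τ) * f τ (X τ)))) := by
    -- The majorant in `τ` comes from the commutator bound and does not depend on `n`.
    refine intervalIntegral.tendsto_integral_filter_of_dominated_convergence
      (fun τ => ‖V τ‖ * ‖f τ‖ * (∫ z, |z * deriv η z|) + (∫ z, |η z|) * ‖S τ‖)
      (Eventually.of_forall fun n => (hDc n).aestronglyMeasurable)
      (Eventually.of_forall fun n => Eventually.of_forall fun τ _ => ?_)
      (by apply Continuous.intervalIntegrable; fun_prop)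
      (Eventually.of_forall fun τ _ => ?_)
    · rw [eD]
      refine (norm_add_le _ _).trans (add_le_add ?_ ?_)
      · rw [← integral_const_mul]
        exact norm_integral_le_of_norm_le (hzi.abs.const_mul _)
          (Eventually.of_forall fun z => abs_commutator_le (hd τ) (f τ) (hp n) _ _ _)
      · rw [← integral_mul_const]
        refine norm_integral_le_of_norm_le (hη.integrable.abs.mul_const _)
          (Eventually.of_forall fun z => ?_)
        rw [norm_mul]
        exact mul_le_mul_of_nonneg_left ((S τ).norm_coe_le_norm _) (abs_nonneg _)
    · have l1 := tendsto_commutator hη (hd τ) (f τ) (X τ)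
      have l2 := tendsto_integral_mul_comp_sub hη.integrable (S τ) (X τ)
      refine ((l1.add l2).congr fun n => (eD n τ).symm).trans_eq ?_
      rw [hη1]
      congr 1
      ring
  refine tendsto_nhds_unique ((hlim (f c) (X c)).sub (hlim (f a) (X a))) ?_
  exact hI.congr fun n => (hFTC n).symm

/-! ### The flow of a Lipschitz velocity -/

theorem lipschitzWith_of_deriv_le {M : ℝ} {U V : ℝ →ᵇ ℝ} (hd : ∀ x, HasDerivAt U (V x) x)
    (hM : ∀ x, |V x| ≤ M) : LipschitzWith M.toNNReal U := by
  refine lipschitzWith_of_nnnorm_deriv_le (fun x => (hd x).differentiableAt) fun x => ?_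
  rw [(hd x).deriv, ← NNReal.coe_le_coe, coe_nnnorm]
  exact (hM x).trans (Real.le_coe_toNNReal M)

theorem exists_trajectory {M : ℝ} (hM : 0 ≤ M) {U V : ℝ → ℝ →ᵇ ℝ} (hU : Continuous U)
    (hd : ∀ t x, HasDerivAt (U t) (V t x) x) {a c : ℝ}
    (hUM : ∀ t ∈ Icc a c, ∀ x, |U t x| ≤ M) (hVM : ∀ t ∈ Icc a c, ∀ x, |V t x| ≤ M)
    {t₀ : ℝ} (ht₀ : t₀ ∈ Icc a c) (x : ℝ) :
    ∃ X : ℝ → ℝ, Continuous X ∧ X t₀ = x ∧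
      ∀ t ∈ Icc a c, HasDerivWithinAt X (U t (X t)) (Icc a c) t := by
  have hac : a ≤ c := ht₀.1.trans ht₀.2
  have hca : 0 ≤ c - a := sub_nonneg.2 hac
  -- As the velocity is globally bounded by `M`, the radius `M (c - a)` gives a solution on all of
  -- `[a, c]` at once.
  have hPL : IsPicardLindelof (fun t => (U t : ℝ → ℝ)) (⟨t₀, ht₀⟩ : Icc a c) x
      (M * (c - a)).toNNReal 0 M.toNNReal M.toNNReal :=
    { lipschitzOnWith := fun t ht => (lipschitzWith_of_deriv_le (hd t) (hVM t ht)).lipschitzOnWith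
      continuousOn := fun y _ => (continuous_bcf_eval hU continuous_const).continuousOn
      norm_le := fun t ht y _ => (hUM t ht y).trans (Real.le_coe_toNNReal M)
      mul_max_le := by
        rw [Real.coe_toNNReal _ hM, Real.coe_toNNReal _ (by positivity), NNReal.coe_zero, sub_zero]
        refine mul_le_mul_of_nonneg_left (max_le ?_ ?_) hM
        · exact sub_le_sub_left ht₀.1 _
        · exact sub_le_sub_right ht₀.2 _ }
  obtain ⟨X, hX0, hX⟩ := hPL.exists_eq_forall_mem_Icc_hasDerivWithinAt₀
  have hXc : ContinuousOn X (Icc a c) := fun t ht => (hX t ht).continuousWithinAt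
  have e : ∀ t ∈ Icc a c, IccExtend hac ((Icc a c).domRestrict X) t = X t := fun t ht => by
    rw [IccExtend_of_mem hac _ ht]; rfl
  refine ⟨IccExtend hac ((Icc a c).domRestrict X),
    (continuousOn_iff_continuous_domRestrict.1 hXc).Icc_extend', ?_, fun t ht => ?_⟩
  · rw [e _ ht₀, ← hX0]
  · rw [e t ht]
    exact (hX t ht).congr e (e t ht)

theorem trajectory_dist_le {M : ℝ} (hM : 0 ≤ M) {U V : ℝ → ℝ →ᵇ ℝ}
    (hd : ∀ t x, HasDerivAt (U t) (V t x) x) {a c : ℝ} (hac : a ≤ c)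
    (hVM : ∀ t ∈ Icc a c, ∀ x, |V t x| ≤ M) {X Y : ℝ → ℝ} (hXc : Continuous X)
    (hYc : Continuous Y) (hX : ∀ t ∈ Icc a c, HasDerivWithinAt X (U t (X t)) (Icc a c) t)
    (hY : ∀ t ∈ Icc a c, HasDerivWithinAt Y (U t (Y t)) (Icc a c) t) :
    dist (X c) (Y c) ≤ dist (X a) (Y a) * Real.exp (M * (c - a)) := by
  have hr : ∀ Z : ℝ → ℝ, (∀ t ∈ Icc a c, HasDerivWithinAt Z (U t (Z t)) (Icc a c) t) →
      ∀ t ∈ Ico a c, HasDerivWithinAt Z (U t (Z t)) (Ici t) t := fun Z hZ t ht =>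
    (hZ t ⟨ht.1, ht.2.le⟩).mono_of_mem_nhdsWithin (Icc_mem_nhdsGE_of_mem ht)
  have := dist_le_of_trajectories_ODE_of_mem (K := M.toNNReal) (v := fun t => (U t : ℝ → ℝ))
    (s := fun _ => univ) (a := a) (b := c) (δ := dist (X a) (Y a))
    (fun t ht => (lipschitzWith_of_deriv_le (hd t) (hVM t ⟨ht.1, ht.2.le⟩)).lipschitzOnWith)
    hXc.continuousOn (hr X hX) (fun _ _ => mem_univ _) hYc.continuousOn (hr Y hY)
    (fun _ _ => mem_univ _) le_rfl c ⟨hac, le_rfl⟩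
  rwa [Real.coe_toNNReal _ hM] at this

theorem trajectory_abs_sub_le {M : ℝ} {U : ℝ → ℝ →ᵇ ℝ} {a c : ℝ}
    (hUM : ∀ t ∈ Icc a c, ∀ x, |U t x| ≤ M) {X : ℝ → ℝ}
    (hX : ∀ t ∈ Icc a c, HasDerivWithinAt X (U t (X t)) (Icc a c) t) {t : ℝ} (ht : t ∈ Icc a c) :
    |X t - X a| ≤ M * (t - a) := by
  have := (convex_Icc a c).norm_image_sub_le_of_norm_hasDerivWithin_le hX
    (fun t ht => hUM t ht _) (left_mem_Icc.2 (ht.1.trans ht.2)) ht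
  rwa [Real.norm_eq_abs, Real.norm_eq_abs, abs_of_nonneg (sub_nonneg.2 ht.1)] at this

theorem exists_flow {M : ℝ} (hM : 0 ≤ M) {U V : ℝ → ℝ →ᵇ ℝ} (hU : Continuous U)
    (hd : ∀ t x, HasDerivAt (U t) (V t x) x) {a c : ℝ} (hac : a ≤ c)
    (hUM : ∀ t ∈ Icc a c, ∀ x, |U t x| ≤ M) (hVM : ∀ t ∈ Icc a c, ∀ x, |V t x| ≤ M) :
    ∃ Φ : ℝ → ℝ → ℝ, (∀ x, Continuous (Φ x)) ∧ (∀ x, Φ x a = x) ∧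
      (∀ x, ∀ t ∈ Icc a c, HasDerivWithinAt (Φ x) (U t (Φ x t)) (Icc a c) t) ∧
      LipschitzWith (Real.exp (M * (c - a))).toNNReal (fun x => Φ x c) ∧
      Function.Surjective (fun x => Φ x c) := by
  choose Φ hΦc hΦ0 hΦ using fun x =>
    exists_trajectory hM hU hd hUM hVM (left_mem_Icc.2 hac) x
  refine ⟨Φ, hΦc, hΦ0, hΦ, LipschitzWith.of_dist_le_mul fun x y => ?_, fun y => ?_⟩
  · have := trajectory_dist_le hM hd hac hVM (hΦc x) (hΦc y) (hΦ x) (hΦ y)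
    rw [hΦ0, hΦ0] at this
    rwa [Real.coe_toNNReal _ (Real.exp_pos _).le, mul_comm]
  -- Surjectivity: solve backward from `y` at time `c`; the flow line issued from `Y a` is the same
  -- trajectory by the stability estimate.
  · obtain ⟨Y, hYc, hY0, hY⟩ := exists_trajectory hM hU hd hUM hVM (right_mem_Icc.2 hac) y
    refine ⟨Y a, ?_⟩
    have := trajectory_dist_le hM hd hac hVM (hΦc (Y a)) hYc (hΦ (Y a)) hY
    rw [hΦ0, dist_self, zero_mul] at this
    rw [← hY0]
    exact dist_le_zero.1 this

/-! ### Change of variables -/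

/-- Lebesgue measure on the line is one-dimensional Hausdorff measure, which an `L`-Lipschitz map
enlarges at most by `L`. Neither injectivity nor a Jacobian of the flow is needed. -/
theorem volume_le_smul_map {L : ℝ≥0} {Y : ℝ → ℝ} (hY : LipschitzWith L Y)
    (hs : Function.Surjective Y) :
    (volume : Measure ℝ) ≤ (L : ℝ≥0∞) • (volume : Measure ℝ).map Y := by
  refine Measure.le_iff.2 fun S hS => ?_
  rw [Measure.smul_apply, Measure.map_apply hY.continuous.measurable hS, smul_eq_mul]
  have := hY.hausdorffMeasure_image_le (d := 1) zero_le_one (Y ⁻¹' S)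
  rw [image_preimage_eq S hs, hausdorffMeasure_real, ENNReal.rpow_one] at this
  exact this

/-- The natural factor is `L ^ (1/p)`; replacing it by `L`, allowed as `L ≥ 1` and `p ≥ 1`, keeps
the final constant independent of `p`. -/
theorem eLpNorm_le_mul_eLpNorm_comp {L : ℝ≥0} (hL : 1 ≤ L) {Y : ℝ → ℝ} (hY : LipschitzWith L Y)
    (hs : Function.Surjective Y) {g : ℝ → ℝ} (hg : Continuous g) {p : ℝ≥0∞} (hp : 1 ≤ p) :
    eLpNorm g p volume ≤ L * eLpNorm (fun x => g (Y x)) p volume := by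
  have hL0 : (L : ℝ≥0∞) ≠ 0 := by
    have : L ≠ 0 := (zero_lt_one.trans_le hL).ne'
    exact_mod_cast this
  refine (eLpNorm_mono_measure g (volume_le_smul_map hY hs)).trans ?_
  rw [eLpNorm_smul_measure_of_ne_zero hL0, eLpNorm_map_measure hg.aestronglyMeasurable
    hY.continuous.aemeasurable, smul_eq_mul]
  refine mul_le_mul_left ?_ _
  have h1 : (1 : ℝ≥0∞) ≤ L := by exact_mod_cast hL
  calc (L : ℝ≥0∞) ^ (1 / p).toReal ≤ (L : ℝ≥0∞) ^ (1 : ℝ) := by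
        refine ENNReal.rpow_le_rpow_of_exponent_le h1 ?_
        rw [one_div]
        exact ENNReal.toReal_le_of_le_ofReal zero_le_one (by simpa using hp)
    _ = L := ENNReal.rpow_one _

end BSystem

namespace BSystem

open Filter Topology Asymptotics
open scoped BoundedContinuousFunction Convolution NNReal

/-! ### Admissible weights and their truncations -/

/-- A positive weight with logarithmic Lipschitz constant `A`, moderate with respect to `w`. -/
structure IsLogLipschitzModerate (A : ℝ) (w φ : ℝ → ℝ) : Prop where
  pos : ∀ x, 0 < φ x
  le_exp_mul : ∀ x y, φ y ≤ Real.exp (A * |y - x|) * φ x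
  le_mul : ∀ x y, φ (x + y) ≤ w x * φ y

/-- `e^{-Az} φ` is nonincreasing and `e^{Az} φ` nondecreasing: absolute continuity turns the almost
everywhere sign of the derivative into monotonicity. -/
theorem le_exp_mul_of_absolutelyContinuous {φ : ℝ → ℝ} {A : ℝ}
    (hac : ∀ a c : ℝ, AbsolutelyContinuousOnInterval φ a c) (hpos : ∀ x, 0 < φ x)
    (hA : ∀ᵐ x, |deriv φ x| ≤ A * |φ x|) (x y : ℝ) :
    φ y ≤ Real.exp (A * |y - x|) * φ x := by
  have key : ∀ B a c : ℝ,
      Real.exp (B * c) * φ c - Real.exp (B * a) * φ a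
        = ∫ z in a..c, Real.exp (B * z) * (B * φ z + deriv φ z) := by
    intro B a c
    have he : ∀ z, HasDerivAt (fun z => Real.exp (B * z)) (Real.exp (B * z) * B) z := fun z => by
      simpa using ((hasDerivAt_id z).const_mul B).exp
    have hE : AbsolutelyContinuousOnInterval (fun z => Real.exp (B * z)) a c :=
      ContDiffOn.absolutelyContinuousOnInterval
        (by fun_prop : ContDiff ℝ 1 fun z => Real.exp (B * z)).contDiffOn
    have h := (hE.mul (hac a c)).integral_deriv_eq_sub
    simp only [Pi.mul_apply] at h
    rw [← h]
    refine intervalIntegral.integral_congr_ae ?_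
    filter_upwards [(hac a c).ae_differentiableAt] with z hz hzm
    have hd := (hz (uIoc_subset_uIcc hzm)).hasDerivAt
    rw [((he z).mul hd).deriv]
    ring
  have hφ : ∀ z, |φ z| = φ z := fun z => abs_of_pos (hpos z)
  rcases le_total x y with hxy | hxy
  · have h := key (-A) x y
    have hle : ∫ z in x..y, Real.exp (-A * z) * (-A * φ z + deriv φ z) ≤ 0 := by
      rw [← neg_nonneg, ← intervalIntegral.integral_neg]
      refine intervalIntegral.integral_nonneg_of_ae hxy ?_
      filter_upwards [hA] with z hz
      rw [hφ] at hz
      have := le_abs_self (deriv φ z)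
      exact neg_nonneg.2
        (mul_nonpos_of_nonneg_of_nonpos (Real.exp_pos _).le (by linarith))
    rw [← h, sub_nonpos] at hle
    rw [abs_of_nonneg (sub_nonneg.2 hxy)]
    calc φ y = Real.exp (A * y) * (Real.exp (-A * y) * φ y) := by
          rw [← mul_assoc, ← Real.exp_add]; simp
      _ ≤ Real.exp (A * y) * (Real.exp (-A * x) * φ x) := by gcongr
      _ = _ := by rw [← mul_assoc, ← Real.exp_add]; ring_nf
  · have h := key A y x
    have hle : 0 ≤ ∫ z in y..x, Real.exp (A * z) * (A * φ z + deriv φ z) := by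
      refine intervalIntegral.integral_nonneg_of_ae hxy ?_
      filter_upwards [hA] with z hz
      rw [hφ] at hz
      have := neg_abs_le (deriv φ z)
      exact mul_nonneg (Real.exp_pos _).le (by linarith)
    rw [← h, sub_nonneg] at hle
    rw [abs_of_nonpos (sub_nonpos.2 hxy)]
    calc φ y = Real.exp (-A * y) * (Real.exp (A * y) * φ y) := by
          rw [← mul_assoc, ← Real.exp_add]; simp
      _ ≤ Real.exp (-A * y) * (Real.exp (A * x) * φ x) := by gcongr
      _ = _ := by rw [← mul_assoc, ← Real.exp_add]; ring_nf

/-- The weight `φ` cut at the height of an integrable exponential. -/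
noncomputable def truncWeight (φ : ℝ → ℝ) (n : ℕ) (x : ℝ) : ℝ :=
  min (φ x) (((n : ℝ) + 1) * Real.exp (-(1 / 2) * |x|))

theorem exp_neg_half_abs_le (x y : ℝ) :
    Real.exp (-(1 / 2) * |x|) ≤ Real.exp ((1 / 2) * |x - y|) * Real.exp (-(1 / 2) * |y|) := by
  rw [← Real.exp_add]
  apply Real.exp_le_exp.2
  have := abs_sub_abs_le_abs_sub y x
  rw [abs_sub_comm] at this
  linarith

/-- Both bounds pass to a minimum, and `e^{-|x|/2}` satisfies them with rate `1/2` and weight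
`e^{|x|/2}`. The height `n + 1` scales out, so the constants are uniform in `n`; a rate below `1`
keeps `green * w` integrable. -/
theorem isLogLipschitzModerate_truncWeight {φ v : ℝ → ℝ} {A C₀ : ℝ} (hpos : ∀ x, 0 < φ x)
    (hlip : ∀ x y, φ y ≤ Real.exp (A * |y - x|) * φ x)
    (hv : ∀ x, 0 ≤ v x) (hC₀ : 0 ≤ C₀) (hmod : ∀ x y, φ (x + y) ≤ C₀ * v x * φ y) (n : ℕ) :
    IsLogLipschitzModerate (max A (1 / 2)) (fun x => C₀ * v x + Real.exp ((1 / 2) * |x|))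
      (truncWeight φ n) where
  pos x := lt_min (hpos x) (by positivity)
  le_exp_mul x y := by
    unfold truncWeight
    rw [mul_min_of_nonneg _ _ (Real.exp_pos _).le]
    refine min_le_min ?_ ?_
    · refine (hlip x y).trans (mul_le_mul_of_nonneg_right ?_ (hpos x).le)
      exact Real.exp_le_exp.2 (mul_le_mul_of_nonneg_right (le_max_left _ _) (abs_nonneg _))
    · rw [mul_left_comm]
      refine mul_le_mul_of_nonneg_left ?_ (by positivity)
      refine (exp_neg_half_abs_le y x).trans (mul_le_mul_of_nonneg_right ?_ (Real.exp_pos _).le)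
      exact Real.exp_le_exp.2 (mul_le_mul_of_nonneg_right (le_max_right _ _) (abs_nonneg _))
  le_mul x y := by
    unfold truncWeight
    have h1 : 0 ≤ C₀ * v x := mul_nonneg hC₀ (hv x)
    have h2 := Real.exp_pos ((1 / 2) * |x|)
    rw [mul_min_of_nonneg _ _ (by positivity)]
    refine min_le_min ?_ ?_
    · exact (hmod x y).trans (mul_le_mul_of_nonneg_right (by linarith) (hpos y).le)
    · rw [mul_left_comm]
      refine mul_le_mul_of_nonneg_left ?_ (by positivity)
      have := exp_neg_half_abs_le (x + y) y
      rw [add_sub_cancel_right] at this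
      exact this.trans (mul_le_mul_of_nonneg_right (by linarith) (Real.exp_pos _).le)

theorem memLp_truncWeight {φ : ℝ → ℝ} (hpos : ∀ x, 0 < φ x) (hφ : Continuous φ) (n : ℕ)
    (p : ℝ≥0∞) : MemLp (truncWeight φ n) p volume := by
  have hc : Continuous fun x : ℝ => Real.exp (-(1 / 2) * |x|) := by fun_prop
  have h1 : MemLp (fun x : ℝ => Real.exp (-(1 / 2) * |x|)) p volume := by
    rcases eq_or_ne p 0 with rfl | hp0
    · exact memLp_zero_iff_aestronglyMeasurable.2 hc.aestronglyMeasurable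
    rcases eq_or_ne p ∞ with rfl | hp
    · refine memLp_top_of_bound hc.aestronglyMeasurable 1 (Eventually.of_forall fun x => ?_)
      rw [Real.norm_of_nonneg (Real.exp_pos _).le]
      exact Real.exp_le_one_iff.2 (by nlinarith [abs_nonneg x])
    · rw [← integrable_norm_rpow_iff hc.aestronglyMeasurable hp0 hp]
      have hp' := ENNReal.toReal_pos hp0 hp
      refine (integrable_exp_neg_mul_abs (c := p.toReal / 2) (by positivity)).congr
        (Eventually.of_forall fun x => ?_)
      simp only
      rw [Real.norm_of_nonneg (Real.exp_pos _).le, ← Real.exp_mul]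
      ring_nf
  refine (h1.const_mul ((n : ℝ) + 1)).mono ?_ (Eventually.of_forall fun x => ?_)
  · exact (hφ.min (by fun_prop)).aestronglyMeasurable
  · have h0 : 0 < truncWeight φ n x := lt_min (hpos x) (by positivity)
    rw [Real.norm_of_nonneg h0.le, Real.norm_of_nonneg (by positivity)]
    exact min_le_right _ _

theorem truncWeight_eventually_eq (φ : ℝ → ℝ) (x : ℝ) :
    ∀ᶠ n : ℕ in atTop, truncWeight φ n x = φ x := by
  have h : Tendsto (fun n : ℕ => ((n : ℝ) + 1) * Real.exp (-(1 / 2) * |x|)) atTop atTop :=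
    (tendsto_atTop_add_const_right _ _ tendsto_natCast_atTop_atTop).atTop_mul_const
      (Real.exp_pos _)
  filter_upwards [h.eventually_ge_atTop (φ x)] with n hn
  exact min_eq_left hn

/-! ### Young's inequality -/

/-- Jensen's inequality in unnormalized form, for the measure with density `K`. -/
theorem lintegral_kernel_rpow_le {K G : ℝ → ℝ≥0∞} (hK : AEMeasurable K) (hG : Measurable G)
    {q : ℝ} (hq : 1 ≤ q) (x : ℝ) :
    (∫⁻ y, K y * G (x - y)) ^ q
      ≤ (∫⁻ y, K y) ^ (q - 1) * ∫⁻ y, K y * G (x - y) ^ q := by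
  have hq0 : 0 < q := by linarith
  set ν := (volume : Measure ℝ).withDensity K
  have hm : Measurable fun y => G (x - y) := hG.comp (by fun_prop)
  have e1 : ∫⁻ y, G (x - y) ∂ν = ∫⁻ y, K y * G (x - y) :=
    lintegral_withDensity_eq_lintegral_mul₀ hK hm.aemeasurable
  have e2 : ∫⁻ y, G (x - y) ^ q ∂ν = ∫⁻ y, K y * G (x - y) ^ q :=
    lintegral_withDensity_eq_lintegral_mul₀ hK (hm.pow_const q).aemeasurable
  have e3 : ν univ = ∫⁻ y, K y := by simp [ν, withDensity_apply]
  have h := eLpNorm'_le_eLpNorm'_mul_rpow_measure_univ (μ := ν) zero_lt_one hq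
    (hm.aestronglyMeasurable (μ := ν))
  simp only [eLpNorm', enorm_eq_self, ENNReal.rpow_one, div_one, e1, e2, e3] at h
  have h2 := ENNReal.rpow_le_rpow h hq0.le
  rw [ENNReal.mul_rpow_of_nonneg _ _ hq0.le, ← ENNReal.rpow_mul, ← ENNReal.rpow_mul,
    one_div_mul_cancel hq0.ne', ENNReal.rpow_one, mul_comm] at h2
  convert h2 using 3
  field_simp

theorem eLpNorm_lintegral_kernel_le {K G : ℝ → ℝ≥0∞} (hK : AEMeasurable K)
    (hKi : ∫⁻ y, K y ≠ ⊤) (hG : Measurable G)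
    {p : ℝ≥0∞} (hp : 1 ≤ p) :
    eLpNorm (fun x => ∫⁻ y, K y * G (x - y)) p volume ≤ (∫⁻ y, K y) * eLpNorm G p volume := by
  rcases eq_or_ne p ∞ with rfl | hp'
  · rw [eLpNorm_exponent_top, eLpNorm_exponent_top]
    refine eLpNormEssSup_le_of_ae_enorm_bound (Eventually.of_forall fun x => ?_)
    rw [enorm_eq_self, ← lintegral_mul_const'' _ hK]
    refine lintegral_mono_ae ?_
    have h1 : ∀ᵐ y : ℝ, ‖G y‖ₑ ≤ eLpNormEssSup G volume := enorm_ae_le_eLpNormEssSup G volume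
    have h2 := (Measure.measurePreserving_sub_left (volume : Measure ℝ) x).quasiMeasurePreserving.ae h1
    filter_upwards [h2] with y hy
    rw [enorm_eq_self] at hy
    gcongr
  · have hp0 : p ≠ 0 := (zero_lt_one.trans_le hp).ne'
    set q := p.toReal with hq
    have hq1 : 1 ≤ q := by
      rw [hq, ← ENNReal.toReal_one]
      exact ENNReal.toReal_mono hp' hp
    have hq0 : 0 < q := by linarith
    rw [eLpNorm_eq_lintegral_rpow_enorm_toReal hp0 hp',
      eLpNorm_eq_lintegral_rpow_enorm_toReal hp0 hp']
    simp only [enorm_eq_self, ← hq]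
    have hswap : ∫⁻ x, ∫⁻ y, K y * G (x - y) ^ q = (∫⁻ y, K y) * ∫⁻ x, G x ^ q := by
      rw [lintegral_lintegral_swap]
      · rw [← lintegral_mul_const'' _ hK]
        congr 1
        ext y
        have hm : Measurable fun x => G (x - y) ^ q := (hG.comp (by fun_prop)).pow_const q
        rw [lintegral_const_mul _ hm, lintegral_sub_right_eq_self (fun x => G x ^ q) y]
      · exact (hK.comp_snd).mul
          ((hG.comp (measurable_fst.sub measurable_snd)).pow_const q).aemeasurable
    calc (∫⁻ x, (∫⁻ y, K y * G (x - y)) ^ q) ^ (1 / q)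
        ≤ (∫⁻ x, (∫⁻ y, K y) ^ (q - 1) * ∫⁻ y, K y * G (x - y) ^ q) ^ (1 / q) := by
          gcongr with x
          exact lintegral_kernel_rpow_le hK hG hq1 x
      _ = ((∫⁻ y, K y) ^ (q - 1) * ((∫⁻ y, K y) * ∫⁻ x, G x ^ q)) ^ (1 / q) := by
          rw [lintegral_const_mul' _ _ (ENNReal.rpow_ne_top_of_nonneg (by linarith) hKi), hswap]
      _ = (∫⁻ y, K y) * (∫⁻ x, G x ^ q) ^ (1 / q) := by
          have e : (∫⁻ y, K y) ^ (q - 1) * (∫⁻ y, K y) = (∫⁻ y, K y) ^ q := by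
            have := ENNReal.rpow_add_of_nonneg (x := ∫⁻ y, K y) (q - 1) 1 (by linarith) zero_le_one
            rw [sub_add_cancel, ENNReal.rpow_one] at this
            exact this.symm
          rw [← mul_assoc, e, ENNReal.mul_rpow_of_nonneg _ _ (by positivity), ← ENNReal.rpow_mul,
            mul_one_div_cancel hq0.ne', ENNReal.rpow_one]

end BSystem

namespace BSystem

open Filter Topology Asymptotics
open scoped BoundedContinuousFunction Convolution NNReal

/-! ### The weighted norm -/

theorem IsLogLipschitzModerate.continuous {A : ℝ} {w φ : ℝ → ℝ}
    (h : IsLogLipschitzModerate A w φ) : Continuous φ := by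
  rw [continuous_iff_continuousAt]
  intro x
  have h1 : Tendsto (fun y => Real.exp (A * |y - x|) * φ x) (𝓝 x) (𝓝 (φ x)) := by
    have : Continuous fun y => Real.exp (A * |y - x|) * φ x := by fun_prop
    simpa using this.tendsto x
  have h2 : Tendsto (fun y => Real.exp (-(A * |x - y|)) * φ x) (𝓝 x) (𝓝 (φ x)) := by
    have : Continuous fun y => Real.exp (-(A * |x - y|)) * φ x := by fun_prop
    simpa using this.tendsto x
  refine tendsto_of_tendsto_of_tendsto_of_le_of_le h2 h1 (fun y => ?_) fun y => h.le_exp_mul x y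
  simp only
  rw [Real.exp_neg, inv_mul_le_iff₀ (Real.exp_pos _)]
  exact h.le_exp_mul y x

/-- The weighted norm `‖f φ‖_p`, as a real number. -/
noncomputable def wnorm (p : ℝ≥0∞) (φ f : ℝ → ℝ) : ℝ :=
  (eLpNorm (fun x => f x * φ x) p volume).toReal

section

variable {p : ℝ≥0∞} {φ : ℝ → ℝ}

theorem wnorm_nonneg (f : ℝ → ℝ) : 0 ≤ wnorm p φ f := ENNReal.toReal_nonneg

theorem memLp_bcf_mul (hφ : MemLp φ p volume) (f : ℝ →ᵇ ℝ) :
    MemLp (fun x => f x * φ x) p volume := by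
  refine (hφ.const_mul ‖f‖).mono (f.continuous.aestronglyMeasurable.mul hφ.1)
    (Eventually.of_forall fun x => ?_)
  rw [norm_mul, norm_mul, norm_norm]
  exact mul_le_mul_of_nonneg_right (f.norm_coe_le_norm x) (norm_nonneg _)

/-- The integrability of `g φ` cannot be dropped: an infinite norm has real value `0`. -/
theorem wnorm_le_of_abs_le {f g : ℝ → ℝ} (hg : MemLp (fun x => g x * φ x) p volume)
    (h : ∀ x, |f x| ≤ |g x|) : wnorm p φ f ≤ wnorm p φ g := by
  refine ENNReal.toReal_mono hg.2.ne (eLpNorm_mono fun x => ?_)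
  rw [norm_mul, norm_mul]
  exact mul_le_mul_of_nonneg_right (h x) (norm_nonneg _)

theorem wnorm_const_mul (c : ℝ) (f : ℝ → ℝ) :
    wnorm p φ (fun x => c * f x) = |c| * wnorm p φ f := by
  have : (fun x => c * f x * φ x) = c • fun x => f x * φ x := by
    ext x
    simp [mul_assoc]
  rw [wnorm, wnorm, this, eLpNorm_const_smul, ENNReal.toReal_mul]
  simp

theorem wnorm_add_le (hp : 1 ≤ p) {f g : ℝ → ℝ} (hf : MemLp (fun x => f x * φ x) p volume)
    (hg : MemLp (fun x => g x * φ x) p volume) :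
    wnorm p φ (fun x => f x + g x) ≤ wnorm p φ f + wnorm p φ g := by
  rw [wnorm, wnorm, wnorm, ← ENNReal.toReal_add hf.2.ne hg.2.ne]
  refine ENNReal.toReal_mono (ENNReal.add_ne_top.2 ⟨hf.2.ne, hg.2.ne⟩) ?_
  refine le_trans (le_of_eq ?_) (eLpNorm_add_le hf.1 hg.1 hp)
  congr 1
  ext x
  simp [add_mul]

theorem wnorm_abs (f : ℝ → ℝ) : wnorm p φ (fun x => |f x|) = wnorm p φ f := by
  rw [wnorm, wnorm]
  congr 1
  exact eLpNorm_congr_norm_ae (Eventually.of_forall fun x => by simp)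

theorem wnorm_le_norm_mul (hφ : MemLp φ p volume) (f : ℝ →ᵇ ℝ) :
    wnorm p φ f ≤ ‖f‖ * wnorm p φ (fun _ => 1) := by
  have h1 : MemLp (fun x => ‖f‖ * 1 * φ x) p volume := by simpa using hφ.const_mul ‖f‖
  refine (wnorm_le_of_abs_le (g := fun _ => ‖f‖ * 1) h1 fun x => ?_).trans_eq ?_
  · simpa using f.norm_coe_le_norm x
  · rw [wnorm_const_mul, abs_norm]

theorem abs_wnorm_sub_le (hp : 1 ≤ p) (hφ : MemLp φ p volume) (f g : ℝ →ᵇ ℝ) :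
    |wnorm p φ f - wnorm p φ g| ≤ ‖f - g‖ * wnorm p φ (fun _ => 1) := by
  have key : ∀ f g : ℝ →ᵇ ℝ, wnorm p φ f - wnorm p φ g ≤ ‖f - g‖ * wnorm p φ (fun _ => 1) := by
    intro f g
    have h := wnorm_add_le hp (memLp_bcf_mul hφ (f - g)) (memLp_bcf_mul hφ g)
    have e : (fun x => (f - g) x + g x) = f := by ext x; simp
    rw [e] at h
    linarith [wnorm_le_norm_mul hφ (f - g)]
  rw [abs_le]
  refine ⟨?_, key f g⟩
  have := key g f
  rw [norm_sub_rev] at this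
  linarith

theorem continuous_wnorm (hp : 1 ≤ p) (hφ : MemLp φ p volume) {f : ℝ → ℝ →ᵇ ℝ}
    (hf : Continuous f) : Continuous fun t => wnorm p φ (f t) := by
  have h : LipschitzWith (wnorm p φ (fun _ => 1)).toNNReal fun g : ℝ →ᵇ ℝ => wnorm p φ g := by
    refine LipschitzWith.of_dist_le_mul fun f g => ?_
    rw [Real.dist_eq, dist_eq_norm, Real.coe_toNNReal _ (wnorm_nonneg _), mul_comm]
    exact abs_wnorm_sub_le hp hφ f g
  exact h.continuous.comp hf

/-- Moderateness in the form `φ x ≤ w y * φ (x - y)` moves the weight inside the convolution,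
leaving the kernel `green * w` acting on `|F φ|`; Young's inequality finishes. -/
theorem wnorm_kconv_le {A : ℝ} {w : ℝ → ℝ} (hφ : IsLogLipschitzModerate A w φ)
    (hφp : MemLp φ p volume) (hp : 1 ≤ p) (hw : Integrable fun y => green y * w y)
    (hw0 : ∀ y, 0 ≤ w y) {k : ℝ → ℝ} (hk : Integrable k) (hkg : ∀ y, |k y| ≤ green y)
    (F : ℝ →ᵇ ℝ) : wnorm p φ (kconvBCF k hk F) ≤ (∫ y, green y * w y) * wnorm p φ F := by
  have hg0 : ∀ y, 0 ≤ green y := fun y => by unfold green; positivity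
  have hgw : ∀ y, 0 ≤ green y * w y := fun y => mul_nonneg (hg0 y) (hw0 y)
  set K : ℝ → ℝ≥0∞ := fun y => ENNReal.ofReal (green y * w y) with hK
  set G : ℝ → ℝ≥0∞ := fun y => ‖F y * φ y‖ₑ with hG
  have hKint : ∫⁻ y, K y = ENNReal.ofReal (∫ y, green y * w y) :=
    (ofReal_integral_eq_lintegral_ofReal hw (Eventually.of_forall hgw)).symm
  have hGm : Measurable G := (F.continuous.mul hφ.continuous).measurable.enorm
  have h1 : ∀ x, ‖kconvBCF k hk F x * φ x‖ₑ ≤ ‖∫⁻ y, K y * G (x - y)‖ₑ := by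
    intro x
    rw [enorm_mul, kconvBCF_apply, enorm_eq_self]
    calc ‖∫ y, k y * F (x - y)‖ₑ * ‖φ x‖ₑ ≤ (∫⁻ y, ‖k y * F (x - y)‖ₑ) * ‖φ x‖ₑ := by
          gcongr
          exact enorm_integral_le_lintegral_enorm _
      _ = ∫⁻ y, ‖k y * F (x - y)‖ₑ * ‖φ x‖ₑ := by
          rw [lintegral_mul_const' _ _ enorm_ne_top]
      _ ≤ ∫⁻ y, K y * G (x - y) := by
          refine lintegral_mono fun y => ?_
          simp only [hK, hG]
          rw [← enorm_mul, ← Real.enorm_of_nonneg (hgw y), ← enorm_mul, enorm_le_iff_norm_le]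
          simp only [norm_mul, Real.norm_eq_abs, abs_of_pos (hφ.pos _), abs_of_nonneg (hg0 y),
            abs_of_nonneg (hw0 y)]
          have hm := hφ.le_mul y (x - y)
          rw [add_sub_cancel] at hm
          calc |k y| * |F (x - y)| * φ x ≤ green y * |F (x - y)| * (w y * φ (x - y)) := by
                have := (hφ.pos x).le
                have := hg0 y
                gcongr
                exact hkg y
            _ = _ := by ring
  have h2 := eLpNorm_lintegral_kernel_le (K := K) hw.1.aemeasurable.ennreal_ofReal
    (by rw [hKint]; exact ENNReal.ofReal_ne_top) hGm hp
  have h3 : eLpNorm G p volume = eLpNorm (fun x => F x * φ x) p volume := eLpNorm_enorm _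
  rw [hKint, h3] at h2
  have h4 := (eLpNorm_mono_enorm h1).trans h2
  have h5 := ENNReal.toReal_mono
    (ENNReal.mul_ne_top ENNReal.ofReal_ne_top (memLp_bcf_mul hφp F).2.ne) h4
  rwa [ENNReal.toReal_mul, ENNReal.toReal_ofReal (integral_nonneg hgw)] at h5

/-- The factor `L` is the change of variables; `exp (A * d)` is the cost of moving the weight from
`Y x` back to `x`. -/
theorem wnorm_le_of_comp_le {A : ℝ} {w : ℝ → ℝ} (hφ : IsLogLipschitzModerate A w φ)
    (hA : 0 ≤ A) (hp : 1 ≤ p) {L d : ℝ} (hL : 1 ≤ L) {Y : ℝ → ℝ}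
    (hY : LipschitzWith L.toNNReal Y) (hs : Function.Surjective Y) (hYd : ∀ x, |Y x - x| ≤ d)
    (g : ℝ →ᵇ ℝ) {k : ℝ → ℝ} (hk : MemLp (fun x => k x * φ x) p volume)
    (h : ∀ x, |g (Y x)| ≤ |k x|) :
    wnorm p φ g ≤ L * Real.exp (A * d) * wnorm p φ k := by
  have h1 := eLpNorm_le_mul_eLpNorm_comp (by simpa using hL) hY hs
    (g.continuous.mul hφ.continuous) hp
  have h2 : eLpNorm (fun x => g (Y x) * φ (Y x)) p volume
      ≤ ENNReal.ofReal (Real.exp (A * d)) * eLpNorm (fun x => k x * φ x) p volume := by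
    refine eLpNorm_le_mul_eLpNorm_of_ae_le_mul (Eventually.of_forall fun x => ?_) p
    rw [norm_mul, norm_mul, Real.norm_of_nonneg (hφ.pos _).le, Real.norm_of_nonneg (hφ.pos _).le]
    have e1 : φ (Y x) ≤ Real.exp (A * d) * φ x := by
      refine (hφ.le_exp_mul x (Y x)).trans (mul_le_mul_of_nonneg_right ?_ (hφ.pos x).le)
      exact Real.exp_le_exp.2 (mul_le_mul_of_nonneg_left (hYd x) hA)
    calc ‖g (Y x)‖ * φ (Y x) ≤ ‖k x‖ * (Real.exp (A * d) * φ x) :=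
          mul_le_mul (h x) e1 (hφ.pos _).le (norm_nonneg _)
      _ = _ := by ring
  have h3 := h1.trans (mul_le_mul_right h2 _)
  have h4 := ENNReal.toReal_mono (ENNReal.mul_ne_top ENNReal.coe_ne_top
    (ENNReal.mul_ne_top ENNReal.ofReal_ne_top hk.2.ne)) h3
  rw [ENNReal.toReal_mul, ENNReal.toReal_mul, ENNReal.toReal_ofReal (Real.exp_pos _).le,
    ENNReal.coe_toReal, Real.coe_toNNReal _ (by linarith), ← mul_assoc] at h4
  exact h4

end

end BSystem

namespace BSystem

open Filter Topology
open scoped BoundedContinuousFunction NNReal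

/-! ### Growth of the weighted norm under transport -/

theorem uniformContinuous_bcf_mul {f g : ℝ →ᵇ ℝ} (hf : UniformContinuous f)
    (hg : UniformContinuous g) : UniformContinuous (f * g) := by
  have hb : ∀ h : ℝ →ᵇ ℝ, ∃ B, 0 ≤ B ∧ ∀ x, |h x| ≤ B :=
    fun h => ⟨‖h‖, norm_nonneg _, fun x => h.norm_coe_le_norm x⟩
  obtain ⟨B, hB, hfB⟩ := hb f
  obtain ⟨D, hD, hgD⟩ := hb g
  rw [Metric.uniformContinuous_iff] at hf hg ⊢
  intro ε hε
  obtain ⟨δ, hδ, h1⟩ := hf (ε / (B + D + 1)) (by positivity)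
  obtain ⟨η, hη, h2⟩ := hg (ε / (B + D + 1)) (by positivity)
  refine ⟨min δ η, lt_min hδ hη, fun {x y} hxy => ?_⟩
  have a1 := h1 (hxy.trans_le (min_le_left _ _))
  have a2 := h2 (hxy.trans_le (min_le_right _ _))
  rw [Real.dist_eq] at a1 a2 ⊢
  simp only [BoundedContinuousFunction.coe_mul, Pi.mul_apply]
  calc |f x * g x - f y * g y| = |(f x - f y) * g x + f y * (g x - g y)| := by congr 1; ring
    _ ≤ |f x - f y| * |g x| + |f y| * |g x - g y| := by
        rw [← abs_mul, ← abs_mul]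
        exact abs_add_le _ _
    _ ≤ ε / (B + D + 1) * D + B * (ε / (B + D + 1)) := by
        gcongr
        · exact hgD x
        · exact hfB y
    _ = ε * ((B + D) / (B + D + 1)) := by ring
    _ < ε := by
        refine mul_lt_of_lt_one_right hε ?_
        rw [div_lt_one (by positivity)]
        linarith

theorem uniformContinuous_source (α b κ : ℝ) {U V R : ℝ →ᵇ ℝ} (hU : UniformContinuous U)
    (hV : UniformContinuous V) (hR : UniformContinuous R) :
    UniformContinuous (source α b κ U V R) := by
  have h := (((hU.const_smul (-α)).add
    ((uniformContinuous_bcf_mul hU hU).const_smul (b / 2))).add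
    ((uniformContinuous_bcf_mul hV hV).const_smul ((3 - b) / 2))).add
    ((uniformContinuous_bcf_mul hR hR).const_smul (κ / 2))
  exact h

/-- One explicit Euler step along the flow: over a short time `f` changes by `(c - t)` times its
residual at time `t`, up to an error that is uniform in space. -/
theorem WeakTransport.eventually_wnorm_le {T : ℝ} {U V f S : ℝ → ℝ →ᵇ ℝ}
    (h : WeakTransport T U f S) (hU : Continuous U) (hV : Continuous V) (hf : Continuous f)
    (hS : Continuous S) (hd : ∀ t x, HasDerivAt (U t) (V t x) x) {M : ℝ} (hM : 0 ≤ M)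
    (hUM : ∀ t ∈ Icc 0 T, ∀ x, |U t x| ≤ M) (hVM : ∀ t ∈ Icc 0 T, ∀ x, |V t x| ≤ M)
    {p : ℝ≥0∞} (hp : 1 ≤ p) {A : ℝ} {w φ : ℝ → ℝ} (hA : 0 ≤ A)
    (hφ : IsLogLipschitzModerate A w φ) (hφp : MemLp φ p volume) {t : ℝ} (ht : t ∈ Ico 0 T)
    (hr : UniformContinuous (S t - V t * f t)) {ε : ℝ} (hε : 0 < ε) :
    ∀ᶠ c in 𝓝[>] t, wnorm p φ (f c) ≤ Real.exp ((A + 1) * M * (c - t)) *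
      (wnorm p φ (f t) + (c - t) * (wnorm p φ (S t - V t * f t : ℝ →ᵇ ℝ) + ε)) := by
  set r : ℝ → ℝ →ᵇ ℝ := fun τ => S τ - V τ * f τ with hrdef
  have hrc : Continuous r := by fun_prop
  set N := wnorm p φ (fun _ => 1) with hN
  have hN0 : 0 ≤ N := wnorm_nonneg _
  -- The pointwise error is a constant function, whose weighted norm is `ε' N ≤ ε`.
  set ε' := ε / (N + 1) with hε'
  have hε'0 : 0 < ε' := by positivity
  have hε'N : ε' * N ≤ ε := by
    rw [hε', div_mul_eq_mul_div, div_le_iff₀ (by positivity)]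
    nlinarith
  obtain ⟨δ, hδ, hδr⟩ := Metric.uniformContinuous_iff.1 hr (ε' / 2) (by positivity)
  obtain ⟨η, hη, hηr⟩ := Metric.continuous_iff.1 hrc t (ε' / 2) (by positivity)
  -- The three bounds on `c - t` keep `c` in `[0,T]`, keep the residual close to its value at time
  -- `t`, and keep the displacement `M (c - t)` below `δ`.
  have hpos : 0 < min (T - t) (min η (δ / (M + 1))) :=
    lt_min (sub_pos.2 ht.2) (lt_min hη (by positivity))
  filter_upwards [Ioo_mem_nhdsGT (lt_add_of_pos_right t hpos)] with c hc
  have hc0 : 0 < c - t := sub_pos.2 hc.1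
  have hc1 : c - t < min (T - t) (min η (δ / (M + 1))) := by linarith [hc.2]
  have hcT : c ≤ T := by linarith [hc1.trans_le (min_le_left _ _)]
  have hcη : c - t < η := hc1.trans_le ((min_le_right _ _).trans (min_le_left _ _))
  have hcδ : M * (c - t) < δ := by
    have := hc1.trans_le ((min_le_right _ _).trans (min_le_right _ _))
    rw [lt_div_iff₀ (by positivity)] at this
    nlinarith
  have hsub : ∀ τ ∈ Icc t c, τ ∈ Icc 0 T := fun τ hτ => ⟨ht.1.trans hτ.1, hτ.2.trans hcT⟩
  obtain ⟨Φ, hΦc, hΦa, hΦd, hΦL, hΦs⟩ := exists_flow hM hU hd hc.1.le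
    (fun τ hτ => hUM τ (hsub τ hτ)) fun τ hτ => hVM τ (hsub τ hτ)
  have hdist : ∀ x, ∀ τ ∈ Icc t c, |Φ x τ - x| ≤ M * (c - t) := by
    intro x τ hτ
    have := trajectory_abs_sub_le (fun τ hτ => hUM τ (hsub τ hτ)) (hΦd x) hτ
    rw [hΦa] at this
    exact this.trans (mul_le_mul_of_nonneg_left (by linarith [hτ.2]) hM)
  set k : ℝ → ℝ := fun x => (|f t x| + (c - t) * |r t x|) + (c - t) * (ε' * 1) with hk
  have hk0 : ∀ x, 0 ≤ k x := fun x => by positivity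
  have hfk : ∀ x, |f c (Φ x c)| ≤ |k x| := by
    intro x
    rw [abs_of_nonneg (hk0 x)]
    have e := h.along_characteristic hU hV hf hS hd ht.1 hc.1.le hcT (hΦc x) (hΦd x)
    rw [hΦa] at e
    have hi : Continuous fun τ => r τ (Φ x τ) := continuous_bcf_eval hrc (hΦc x)
    have e2 : ∫ τ in t..c, (r τ (Φ x τ) - r t x)
        = (∫ τ in t..c, (S τ (Φ x τ) - V τ (Φ x τ) * f τ (Φ x τ))) - (c - t) * r t x := by
      rw [intervalIntegral.integral_sub (hi.intervalIntegrable _ _)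
        intervalIntegrable_const, intervalIntegral.integral_const, smul_eq_mul]
      rfl
    have e3 : ‖∫ τ in t..c, (r τ (Φ x τ) - r t x)‖ ≤ ε' * |c - t| := by
      refine intervalIntegral.norm_integral_le_of_norm_le_const fun τ hτ => ?_
      rw [uIoc_of_le hc.1.le] at hτ
      have b1 : |r τ (Φ x τ) - r t (Φ x τ)| < ε' / 2 := by
        refine lt_of_le_of_lt ((r τ - r t).norm_coe_le_norm (Φ x τ)) ?_
        rw [← dist_eq_norm]
        refine hηr τ ?_
        rw [Real.dist_eq, abs_of_pos (sub_pos.2 hτ.1)]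
        linarith [hτ.2]
      have b2 : |r t (Φ x τ) - r t x| < ε' / 2 := by
        have := hδr (a := Φ x τ) (b := x)
          ((hdist x τ ⟨hτ.1.le, hτ.2⟩).trans_lt hcδ)
        rwa [Real.dist_eq] at this
      rw [Real.norm_eq_abs]
      linarith [abs_sub_le (r τ (Φ x τ)) (r t (Φ x τ)) (r t x)]
    rw [e2, ← e, Real.norm_eq_abs, abs_of_pos hc0] at e3
    have e4 : f c (Φ x c) = f t x + (c - t) * r t x
        + (f c (Φ x c) - f t x - (c - t) * r t x) := by ring
    rw [e4]
    refine (abs_add_le _ _).trans ?_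
    have e5 := abs_add_le (f t x) ((c - t) * r t x)
    rw [abs_mul, abs_of_pos hc0] at e5
    simp only [hk]
    linarith
  have m1 : MemLp (fun x => |f t x| * φ x) p volume := by
    simpa using memLp_bcf_mul hφp |f t|
  have m2 : MemLp (fun x => (c - t) * |r t x| * φ x) p volume := by
    simpa using memLp_bcf_mul hφp ((c - t) • |r t|)
  have m3 : MemLp (fun x => (c - t) * (ε' * 1) * φ x) p volume := hφp.const_mul _
  have m12 : MemLp (fun x => (|f t x| + (c - t) * |r t x|) * φ x) p volume := by
    simp only [add_mul]
    exact m1.add m2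
  have hkm : MemLp (fun x => k x * φ x) p volume := by
    simp only [hk, add_mul _ ((c - t) * (ε' * 1))]
    exact m12.add m3
  have hwk : wnorm p φ k ≤ wnorm p φ (f t) + (c - t) * (wnorm p φ (r t) + ε) := by
    have w1 := wnorm_add_le hp m12 m3
    have w2 := wnorm_add_le hp m1 m2
    rw [wnorm_const_mul, abs_of_pos hc0, wnorm_abs] at w2
    rw [wnorm_abs] at w2
    rw [wnorm_const_mul, wnorm_const_mul, abs_of_pos hc0, abs_of_pos hε'0] at w1
    have := mul_le_mul_of_nonneg_left hε'N hc0.le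
    linarith
  have hL : 1 ≤ Real.exp (M * (c - t)) := Real.one_le_exp (by positivity)
  refine (wnorm_le_of_comp_le hφ hA hp hL hΦL hΦs
    (fun x => hdist x c ⟨hc.1.le, le_rfl⟩) (f c) hkm hfk).trans ?_
  rw [← Real.exp_add]
  have : M * (c - t) + A * (M * (c - t)) = (A + 1) * M * (c - t) := by ring
  rw [this]
  gcongr

/-- The upper bound for `G c` equals `G t` at `c = t` and has slope `L G + D + ε` there. It
therefore controls a Dini derivative of `G`, which is all Grönwall's inequality requires. -/
theorem le_mul_exp_of_eventually_le {T L Λ : ℝ} {G D : ℝ → ℝ} (hG : Continuous G)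
    (hD : ∀ t ∈ Ico 0 T, D t ≤ Λ * G t)
    (h : ∀ t ∈ Ico 0 T, ∀ ε > 0, ∀ᶠ c in 𝓝[>] t,
      G c ≤ Real.exp (L * (c - t)) * (G t + (c - t) * (D t + ε)))
    {t : ℝ} (ht : t ∈ Icc 0 T) : G t ≤ G 0 * Real.exp ((L + Λ) * t) := by
  have key := le_gronwallBound_of_liminf_deriv_right_le (f := G)
    (f' := fun t => (L + Λ) * G t) (δ := G 0) (K := L + Λ) (ε := 0) hG.continuousOn
    (fun t ht r hr => ?_) le_rfl (fun t _ => by simp) t ht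
  · rwa [gronwallBound_ε0, sub_zero] at key
  · set ε := (r - (L + Λ) * G t) / 2 with hε
    have hε0 : 0 < ε := by
      have : (L + Λ) * G t < r := hr
      rw [hε]
      linarith
    have hder : HasDerivAt (fun c => Real.exp (L * (c - t)) * (G t + (c - t) * (D t + ε)))
        (L * G t + (D t + ε)) t := by
      have e0 : HasDerivAt (fun c => c - t) 1 t := (hasDerivAt_id t).sub_const t
      have e1 := (e0.const_mul L).exp.mul ((e0.mul_const (D t + ε)).const_add (G t))
      simp only [sub_self, mul_zero, Real.exp_zero, zero_mul, add_zero, one_mul, mul_one] at e1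
      exact e1
    have hlt : L * G t + (D t + ε) < r := by
      have := hD t ht
      have : (L + Λ) * G t = L * G t + Λ * G t := by ring
      linarith
    have hsl := (hasDerivAt_iff_tendsto_slope.1 hder).mono_left
      (nhdsWithin_mono t fun y (hy : t < y) => hy.ne')
    refine Eventually.frequently ?_
    filter_upwards [hsl.eventually_lt_const hlt, h t ht ε hε0, self_mem_nhdsWithin]
      with c hc1 hc2 hc3
    refine lt_of_le_of_lt ?_ hc1
    have : 0 < c - t := sub_pos.2 hc3
    rw [slope_def_field, div_eq_inv_mul]
    simp only [sub_self, mul_zero, Real.exp_zero, zero_mul, add_zero, one_mul]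
    gcongr

end BSystem

namespace BSystem

open Filter Topology
open scoped BoundedContinuousFunction NNReal

/-! ### The weighted estimate -/

section

variable {p : ℝ≥0∞} {φ : ℝ → ℝ}

theorem wnorm_bcf_add_le (hp : 1 ≤ p) (hφ : MemLp φ p volume) (f g : ℝ →ᵇ ℝ) :
    wnorm p φ (f + g : ℝ →ᵇ ℝ) ≤ wnorm p φ f + wnorm p φ g :=
  wnorm_add_le hp (memLp_bcf_mul hφ f) (memLp_bcf_mul hφ g)

theorem wnorm_bcf_smul (c : ℝ) (f : ℝ →ᵇ ℝ) :
    wnorm p φ (c • f : ℝ →ᵇ ℝ) = |c| * wnorm p φ f :=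
  wnorm_const_mul c f

theorem wnorm_bcf_neg (f : ℝ →ᵇ ℝ) : wnorm p φ (-f : ℝ →ᵇ ℝ) = wnorm p φ f := by
  have e : -f = (-1 : ℝ) • f := by ext x; simp
  rw [e, wnorm_bcf_smul, abs_neg, abs_one, one_mul]

theorem wnorm_bcf_sub_le (hp : 1 ≤ p) (hφ : MemLp φ p volume) (f g : ℝ →ᵇ ℝ) :
    wnorm p φ (f - g : ℝ →ᵇ ℝ) ≤ wnorm p φ f + wnorm p φ g := by
  rw [sub_eq_add_neg, ← wnorm_bcf_neg g]
  exact wnorm_bcf_add_le hp hφ f (-g)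

theorem wnorm_bcf_mul_le (hφ : MemLp φ p volume) {M : ℝ} (hM : 0 ≤ M) (f g : ℝ →ᵇ ℝ)
    (hf : ∀ x, |f x| ≤ M) : wnorm p φ (f * g : ℝ →ᵇ ℝ) ≤ M * wnorm p φ g := by
  have h := wnorm_le_of_abs_le (f := (f * g : ℝ →ᵇ ℝ)) (memLp_bcf_mul hφ (M • g)) fun x => by
    simp only [BoundedContinuousFunction.coe_mul, Pi.mul_apply,
      BoundedContinuousFunction.coe_smul, smul_eq_mul, abs_mul, abs_of_nonneg hM]
    exact mul_le_mul_of_nonneg_right (hf x) (abs_nonneg _)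
  rwa [wnorm_bcf_smul, abs_of_nonneg hM] at h

/-- The constant in the weighted bound for `source`. -/
noncomputable def sourceConst (α b κ : ℝ) : ℝ := |α| + |b / 2| + |(3 - b) / 2| + |κ / 2|

theorem wnorm_source_le (hp : 1 ≤ p) (hφ : MemLp φ p volume) (α b κ : ℝ) {M : ℝ} (hM : 0 ≤ M)
    (U V R : ℝ →ᵇ ℝ) (hU : ∀ x, |U x| ≤ M) (hV : ∀ x, |V x| ≤ M) (hR : ∀ x, |R x| ≤ M) :
    wnorm p φ (source α b κ U V R) ≤
      sourceConst α b κ * ((1 + M) * (wnorm p φ U + wnorm p φ V + wnorm p φ R)) := by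
  have a1 := wnorm_bcf_add_le hp hφ
    ((-α) • U + (b / 2) • (U * U) + ((3 - b) / 2) • (V * V)) ((κ / 2) • (R * R))
  have a2 := wnorm_bcf_add_le hp hφ
    ((-α) • U + (b / 2) • (U * U)) (((3 - b) / 2) • (V * V))
  have a3 := wnorm_bcf_add_le hp hφ ((-α) • U) ((b / 2) • (U * U))
  simp only [wnorm_bcf_smul, abs_neg] at a1 a2 a3
  have mU := wnorm_bcf_mul_le hφ hM U U hU
  have mV := wnorm_bcf_mul_le hφ hM V V hV
  have mR := wnorm_bcf_mul_le hφ hM R R hR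
  have nU : 0 ≤ wnorm p φ U := wnorm_nonneg _
  have nV : 0 ≤ wnorm p φ V := wnorm_nonneg _
  have nR : 0 ≤ wnorm p φ R := wnorm_nonneg _
  set G := (1 + M) * (wnorm p φ U + wnorm p φ V + wnorm p φ R) with hG
  have pU := mul_nonneg hM nU
  have pV := mul_nonneg hM nV
  have pR := mul_nonneg hM nR
  have b0 : |α| * wnorm p φ U ≤ |α| * G := by gcongr; rw [hG]; linarith
  have b1 : |b / 2| * wnorm p φ (U * U : ℝ →ᵇ ℝ) ≤ |b / 2| * G := by gcongr; rw [hG]; linarith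
  have b2 : |(3 - b) / 2| * wnorm p φ (V * V : ℝ →ᵇ ℝ) ≤ |(3 - b) / 2| * G := by
    gcongr; rw [hG]; linarith
  have b3 : |κ / 2| * wnorm p φ (R * R : ℝ →ᵇ ℝ) ≤ |κ / 2| * G := by gcongr; rw [hG]; linarith
  rw [source, sourceConst]
  linarith

/-- The growth rate of the weighted norm along characteristics. -/
noncomputable def rateConst (α b κ K : ℝ) : ℝ :=
  (1 + 2 * K) * sourceConst α b κ + 1 + |1 - b|

theorem wnorm_residuals_le (hp : 1 ≤ p) (hφp : MemLp φ p volume) {A : ℝ} {w : ℝ → ℝ}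
    (hφ : IsLogLipschitzModerate A w φ) (hw : Integrable fun y => green y * w y)
    (hw0 : ∀ y, 0 ≤ w y) (α b κ : ℝ) {M : ℝ} (hM : 0 ≤ M)
    (U V R F : ℝ →ᵇ ℝ) (hF : F = source α b κ U V R)
    (hU : ∀ x, |U x| ≤ M) (hV : ∀ x, |V x| ≤ M) (hR : ∀ x, |R x| ≤ M) :
    wnorm p φ (U * V - greenDerivConv F - V * U : ℝ →ᵇ ℝ)
      + wnorm p φ (F - greenConv F - V * V : ℝ →ᵇ ℝ)
      + wnorm p φ ((2 - b) • (V * R) - V * R : ℝ →ᵇ ℝ) ≤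
    rateConst α b κ (∫ y, green y * w y) * (1 + M) *
      (wnorm p φ U + wnorm p φ V + wnorm p φ R) := by
  -- The source term `U V` from the conservative form cancels the compression term.
  have e1 : U * V - greenDerivConv F - V * U = -greenDerivConv F := by
    rw [mul_comm]
    abel
  have e3 : (2 - b) • (V * R) - V * R = (1 - b) • (V * R) := by
    ext x
    simp only [BoundedContinuousFunction.coe_sub, BoundedContinuousFunction.coe_smul,
      Pi.sub_apply, smul_eq_mul]
    ring
  have hg0 : ∀ y, 0 ≤ green y := fun y => by unfold green; positivity
  have k1 := wnorm_kconv_le hφ hφp hp hw hw0 integrable_greenDeriv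
    (fun y => (abs_greenDeriv y).le) F
  have k2 := wnorm_kconv_le hφ hφp hp hw hw0 integrable_green
    (fun y => (abs_of_nonneg (hg0 y)).le) F
  have s1 := wnorm_bcf_sub_le hp hφp (F - greenConv F) (V * V)
  have s2 := wnorm_bcf_sub_le hp hφp F (greenConv F)
  have mV := wnorm_bcf_mul_le hφp hM V V hV
  have mR := wnorm_bcf_mul_le hφp hM V R hV
  have hs := wnorm_source_le hp hφp α b κ hM U V R hU hV hR
  rw [← hF] at hs
  rw [e1, e3, wnorm_bcf_neg, wnorm_bcf_smul]
  have nU : 0 ≤ wnorm p φ U := wnorm_nonneg _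
  have nV : 0 ≤ wnorm p φ V := wnorm_nonneg _
  have nR : 0 ≤ wnorm p φ R := wnorm_nonneg _
  have hK : 0 ≤ ∫ y, green y * w y := integral_nonneg fun y => mul_nonneg (hg0 y) (hw0 y)
  set K := ∫ y, green y * w y
  set G := (1 + M) * (wnorm p φ U + wnorm p φ V + wnorm p φ R) with hG
  have pU := mul_nonneg hM nU
  have pV := mul_nonneg hM nV
  have pR := mul_nonneg hM nR
  have g1 : M * wnorm p φ V ≤ G := by rw [hG]; linarith
  have g2 : |1 - b| * wnorm p φ (V * R : ℝ →ᵇ ℝ) ≤ |1 - b| * G := by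
    gcongr
    rw [hG]
    linarith
  have g3 := mul_le_mul_of_nonneg_left hs hK
  -- In `rateConst`, `1 + 2K` counts `F`, `G * F` and `G' * F`; the term `1` is for `V²` and `|1 -
  -- b|` for `V R`.
  rw [mul_assoc, ← hG, rateConst]
  linarith

end

theorem weighted_sum_le_mul_exp {α b κ T : ℝ} {U V R : ℝ → ℝ →ᵇ ℝ}
    (hU : Continuous U) (hV : Continuous V) (hR : Continuous R)
    (hUu : ∀ t, UniformContinuous (U t)) (hVu : ∀ t, UniformContinuous (V t))
    (hRu : ∀ t, UniformContinuous (R t)) (hd : ∀ t x, HasDerivAt (U t) (V t x) x)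
    (h1 : WeakTransport T U U fun t =>
      U t * V t - greenDerivConv (source α b κ (U t) (V t) (R t)))
    (h2 : WeakTransport T U V fun t =>
      source α b κ (U t) (V t) (R t) - greenConv (source α b κ (U t) (V t) (R t)))
    (h3 : WeakTransport T U R fun t => (2 - b) • (V t * R t))
    {M : ℝ} (hM : 0 ≤ M) (hUM : ∀ t ∈ Icc 0 T, ∀ x, |U t x| ≤ M)
    (hVM : ∀ t ∈ Icc 0 T, ∀ x, |V t x| ≤ M) (hRM : ∀ t ∈ Icc 0 T, ∀ x, |R t x| ≤ M)
    {p : ℝ≥0∞} (hp : 1 ≤ p) {A : ℝ} {w φ : ℝ → ℝ} (hA : 0 ≤ A)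
    (hφ : IsLogLipschitzModerate A w φ) (hφp : MemLp φ p volume)
    (hw : Integrable fun y => green y * w y) (hw0 : ∀ y, 0 ≤ w y)
    {t : ℝ} (ht : t ∈ Icc 0 T) :
    wnorm p φ (U t) + wnorm p φ (V t) + wnorm p φ (R t) ≤
      (wnorm p φ (U 0) + wnorm p φ (V 0) + wnorm p φ (R 0)) *
        Real.exp (((A + 1) * M + rateConst α b κ (∫ y, green y * w y) * (1 + M)) * t) := by
  set F : ℝ → ℝ →ᵇ ℝ := fun t => source α b κ (U t) (V t) (R t) with hF
  have hFc : Continuous F := continuous_source α b κ hU hV hR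
  have hFu : ∀ t, UniformContinuous (F t) :=
    fun t => uniformContinuous_source α b κ (hUu t) (hVu t) (hRu t)
  have hgF : Continuous fun t => greenConv (F t) := (continuous_kconvBCF _).comp hFc
  have hdF : Continuous fun t => greenDerivConv (F t) := (continuous_kconvBCF _).comp hFc
  refine le_mul_exp_of_eventually_le
    (G := fun t => wnorm p φ (U t) + wnorm p φ (V t) + wnorm p φ (R t))
    (D := fun t => wnorm p φ (U t * V t - greenDerivConv (F t) - V t * U t : ℝ →ᵇ ℝ)
      + wnorm p φ (F t - greenConv (F t) - V t * V t : ℝ →ᵇ ℝ)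
      + wnorm p φ ((2 - b) • (V t * R t) - V t * R t : ℝ →ᵇ ℝ)) ?_ ?_ ?_ ht
  · exact ((continuous_wnorm hp hφp hU).add (continuous_wnorm hp hφp hV)).add
      (continuous_wnorm hp hφp hR)
  · intro t ht
    have ht' : t ∈ Icc 0 T := ⟨ht.1, ht.2.le⟩
    exact wnorm_residuals_le hp hφp hφ hw hw0 α b κ hM (U t) (V t) (R t) (F t) rfl
      (hUM t ht') (hVM t ht') (hRM t ht')
  · intro t ht ε hε
    have hε3 : 0 < ε / 3 := by positivity
    have u1 : UniformContinuous (U t * V t - greenDerivConv (F t) - V t * U t) :=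
      ((uniformContinuous_bcf_mul (hUu t) (hVu t)).sub
        (uniformContinuous_kconvBCF _ (hFu t))).sub (uniformContinuous_bcf_mul (hVu t) (hUu t))
    have u2 : UniformContinuous (F t - greenConv (F t) - V t * V t) :=
      ((hFu t).sub (uniformContinuous_kconvBCF _ (hFu t))).sub
        (uniformContinuous_bcf_mul (hVu t) (hVu t))
    have u3 : UniformContinuous ((2 - b) • (V t * R t) - V t * R t) :=
      ((uniformContinuous_bcf_mul (hVu t) (hRu t)).const_smul (2 - b)).sub
        (uniformContinuous_bcf_mul (hVu t) (hRu t))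
    filter_upwards [h1.eventually_wnorm_le hU hV hU ((hU.mul hV).sub hdF) hd hM hUM hVM hp hA hφ
        hφp ht u1 hε3,
      h2.eventually_wnorm_le hU hV hV (hFc.sub hgF) hd hM hUM hVM hp hA hφ hφp ht u2 hε3,
      h3.eventually_wnorm_le hU hV hR ((hV.mul hR).const_smul (2 - b)) hd hM hUM hVM hp hA hφ
        hφp ht u3 hε3] with c c1 c2 c3
    refine (add_le_add (add_le_add c1 c2) c3).trans_eq ?_
    ring

end BSystem

namespace BSystem

open Filter Topology
open scoped BoundedContinuousFunction NNReal

/-! ### The uniform bound and the removal of the truncation -/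

theorem eLpNorm_top_bcf_le (f : ℝ →ᵇ ℝ) : eLpNorm f ⊤ volume ≤ ENNReal.ofReal ‖f‖ := by
  rw [eLpNorm_exponent_top]
  exact eLpNormEssSup_le_of_ae_bound (Eventually.of_forall f.norm_coe_le_norm)

/-- The set where the bound holds is closed by continuity and dense because it has full measure. -/
theorem abs_le_of_eLpNorm_top_le {f : ℝ →ᵇ ℝ} {M : ℝ} (hM : 0 ≤ M)
    (h : eLpNorm f ⊤ volume ≤ ENNReal.ofReal M) (x : ℝ) : |f x| ≤ M := by
  have h1 : ∀ᵐ y : ℝ, |f y| ≤ M := by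
    filter_upwards [ae_le_eLpNormEssSup (f := f) (μ := volume)] with y hy
    rw [← eLpNorm_exponent_top] at hy
    have := hy.trans h
    rwa [← ofReal_norm, ENNReal.ofReal_le_ofReal_iff hM] at this
  have h2 : IsClosed {y | |f y| ≤ M} := isClosed_le f.continuous.abs continuous_const
  have h3 : Dense {y | |f y| ≤ M} := Measure.dense_of_ae h1
  have h4 := h2.closure_eq ▸ h3 x
  exact h4

theorem supNorm_congr {T : ℝ} {u ux ρ u' ux' ρ' : ℝ → ℝ → ℝ}
    (h : ∀ t ∈ Icc (0 : ℝ) T, u t =ᵐ[volume] u' t ∧ ux t =ᵐ[volume] ux' t ∧ ρ t =ᵐ[volume] ρ' t) :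
    supNorm T u ux ρ = supNorm T u' ux' ρ' := by
  refine iSup_congr fun t => iSup_congr fun ht => ?_
  obtain ⟨h1, h2, h3⟩ := h t ht
  rw [eLpNorm_congr_ae h1, eLpNorm_congr_ae h2, eLpNorm_congr_ae h3]

theorem supNorm_lt_top (T : ℝ) {U V R : ℝ → ℝ →ᵇ ℝ} (hU : Continuous U) (hV : Continuous V)
    (hR : Continuous R) : supNorm T (fun t => U t) (fun t => V t) (fun t => R t) < ⊤ := by
  obtain ⟨B, hB⟩ := (isCompact_Icc (a := (0 : ℝ)) (b := T)).bddAbove_image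
    ((hU.norm.add hV.norm).add hR.norm).continuousOn
  refine lt_of_le_of_lt (iSup₂_le fun t ht => ?_) (ENNReal.ofReal_lt_top (r := B))
  have h := hB (mem_image_of_mem _ ht)
  refine le_trans (add_le_add (add_le_add (eLpNorm_top_bcf_le _) (eLpNorm_top_bcf_le _))
    (eLpNorm_top_bcf_le _)) ?_
  rw [← ENNReal.ofReal_add (norm_nonneg _) (norm_nonneg _),
    ← ENNReal.ofReal_add (by positivity) (norm_nonneg _)]
  exact ENNReal.ofReal_le_ofReal h

theorem abs_le_supNorm {T : ℝ} {U V R : ℝ → ℝ →ᵇ ℝ}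
    (h : supNorm T (fun t => U t) (fun t => V t) (fun t => R t) < ⊤) {t : ℝ}
    (ht : t ∈ Icc 0 T) (x : ℝ) :
    |U t x| ≤ (supNorm T (fun t => U t) (fun t => V t) (fun t => R t)).toReal ∧
    |V t x| ≤ (supNorm T (fun t => U t) (fun t => V t) (fun t => R t)).toReal ∧
    |R t x| ≤ (supNorm T (fun t => U t) (fun t => V t) (fun t => R t)).toReal := by
  have hsum : eLpNorm (U t) ⊤ volume + eLpNorm (V t) ⊤ volume + eLpNorm (R t) ⊤ volume
      ≤ supNorm T (fun t => U t) (fun t => V t) (fun t => R t) :=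
    le_iSup₂ (f := fun t (_ : t ∈ Icc (0 : ℝ) T) => eLpNorm (U t) ⊤ volume
      + eLpNorm (V t) ⊤ volume + eLpNorm (R t) ⊤ volume) t ht
  rw [← ENNReal.ofReal_toReal h.ne] at hsum
  refine ⟨abs_le_of_eLpNorm_top_le ENNReal.toReal_nonneg (le_trans ?_ hsum) x,
    abs_le_of_eLpNorm_top_le ENNReal.toReal_nonneg (le_trans ?_ hsum) x,
    abs_le_of_eLpNorm_top_le ENNReal.toReal_nonneg (le_trans ?_ hsum) x⟩
  · exact le_self_add.trans le_self_add
  · exact le_add_self.trans le_self_add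
  · exact le_add_self

theorem weightedSum_congr {p : ℝ≥0∞} {φ f g h f' g' h' : ℝ → ℝ} (hf : f =ᵐ[volume] f')
    (hg : g =ᵐ[volume] g') (hh : h =ᵐ[volume] h') :
    weightedSum p φ f g h = weightedSum p φ f' g' h' := by
  have e : ∀ {a a' : ℝ → ℝ}, a =ᵐ[volume] a' →
      eLpNorm (fun x => a x * φ x) p volume = eLpNorm (fun x => a' x * φ x) p volume :=
    fun ha => eLpNorm_congr_ae (ha.mul (EventuallyEq.refl _ φ))
  rw [weightedSum, weightedSum, e hf, e hg, e hh]

theorem weightedSum_eq_ofReal {p : ℝ≥0∞} {φ : ℝ → ℝ} (hφ : MemLp φ p volume)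
    (f g h : ℝ →ᵇ ℝ) :
    weightedSum p φ f g h = ENNReal.ofReal (wnorm p φ f + wnorm p φ g + wnorm p φ h) := by
  rw [ENNReal.ofReal_add (add_nonneg (wnorm_nonneg _) (wnorm_nonneg _)) (wnorm_nonneg _),
    ENNReal.ofReal_add (wnorm_nonneg _) (wnorm_nonneg _), wnorm, wnorm, wnorm,
    ENNReal.ofReal_toReal (memLp_bcf_mul hφ f).2.ne,
    ENNReal.ofReal_toReal (memLp_bcf_mul hφ g).2.ne,
    ENNReal.ofReal_toReal (memLp_bcf_mul hφ h).2.ne, weightedSum]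

theorem eLpNorm_mul_truncWeight_le {φ : ℝ → ℝ} (hpos : ∀ x, 0 < φ x) (p : ℝ≥0∞) (f : ℝ → ℝ) (n : ℕ) :
    eLpNorm (fun x => f x * truncWeight φ n x) p volume
      ≤ eLpNorm (fun x => f x * φ x) p volume := by
  refine eLpNorm_mono fun x => ?_
  have h0 : 0 ≤ truncWeight φ n x := by
    have := hpos x
    unfold truncWeight
    positivity
  rw [norm_mul, norm_mul, Real.norm_of_nonneg h0, Real.norm_of_nonneg (hpos x).le]
  exact mul_le_mul_of_nonneg_left (min_le_left _ _) (norm_nonneg _)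

/-- Fatou's lemma from below and `truncWeight φ n ≤ φ` from above; the limit may be infinite. -/
theorem tendsto_eLpNorm_mul_truncWeight {φ : ℝ → ℝ} (hpos : ∀ x, 0 < φ x) (p : ℝ≥0∞)
    (hφ : Continuous φ) {f : ℝ → ℝ} (hf : Continuous f) :
    Tendsto (fun n => eLpNorm (fun x => f x * truncWeight φ n x) p volume) atTop
      (𝓝 (eLpNorm (fun x => f x * φ x) p volume)) := by
  have hm : ∀ n, Continuous fun x => f x * truncWeight φ n x := fun n => by
    unfold truncWeight
    fun_prop
  refine tendsto_of_le_liminf_of_limsup_le ?_ ?_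
  · refine Lp.eLpNorm_lim_le_liminf_eLpNorm (fun n => (hm n).aestronglyMeasurable) _
      (Eventually.of_forall fun x => ?_)
    refine tendsto_const_nhds.congr' ?_
    filter_upwards [truncWeight_eventually_eq φ x] with n hn
    rw [hn]
  · exact limsup_le_of_le (h := Eventually.of_forall fun n =>
      eLpNorm_mul_truncWeight_le hpos p f n)

end BSystem

/-! ### The weighted estimate for solutions -/

theorem theorem4p1 (α b κ : ℝ) (φ : ℝ → ℝ) (hφ : BSystem.IsAdmissibleWeight φ) :
    ∃ C : ℝ, 0 < C ∧
      ∀ (p : ℝ≥0∞) (_ : 1 ≤ p) (s : ℝ) (_ : 3 / 2 < s) (T : ℝ) (_ : 0 < T)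
        (u₀ u₀x ρ₀ : ℝ → ℝ) (u ux ρ : ℝ → ℝ → ℝ),
        BSystem.MemHs s u₀ → BSystem.MemHs (s - 1) ρ₀ → BSystem.HasWeakDeriv u₀ u₀x →
        MemLp (fun x => u₀ x * φ x) p volume →
        MemLp (fun x => u₀x x * φ x) p volume →
        MemLp (fun x => ρ₀ x * φ x) p volume →
        BSystem.IsSolution α b κ s T u₀ ρ₀ u ux ρ →
        BSystem.supNorm T u ux ρ < ⊤ ∧
        ∀ t ∈ Icc (0 : ℝ) T,
          BSystem.weightedSum p φ (u t) (ux t) (ρ t) ≤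
            BSystem.weightedSum p φ u₀ u₀x ρ₀ *
              ENNReal.ofReal (Real.exp (C * (1 + (BSystem.supNorm T u ux ρ).toReal) * t)) := by
  open BSystem Filter in
  obtain ⟨hac, ⟨A, hA, hder⟩, v, ⟨hv0, hvmul⟩, ⟨c, hc, hcv⟩, hvint, hpos, C₀, hC₀, hmod⟩ := hφ
  have hlip : ∀ x y, φ y ≤ Real.exp (A * |y - x|) * φ x :=
    le_exp_mul_of_absolutelyContinuous hac hpos hder
  have hφc : Continuous φ := by
    rw [← continuousOn_univ]
    intro x _
    have h1 := (hac (x - 1) (x + 1)).continuousOn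
    rw [uIcc_of_le (by linarith)] at h1
    exact (h1.continuousAt (Icc_mem_nhds (by linarith) (by linarith))).continuousWithinAt
  set w : ℝ → ℝ := fun x => C₀ * v x + Real.exp (1 / 2 * |x|) with hw
  have hw0 : ∀ y, 0 ≤ w y := fun y => by
    have := hv0 y
    positivity
  have hgw : Integrable fun y => green y * w y := by
    have h1 := (hvint.const_mul (C₀ / 2)).add
      ((integrable_exp_neg_mul_abs (c := 1 / 2) (by norm_num)).const_mul (1 / 2))
    refine h1.congr (Eventually.of_forall fun y => ?_)
    have e : Real.exp (-(1 / 2) * |y|) = Real.exp (-|y|) * Real.exp (1 / 2 * |y|) := by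
      rw [← Real.exp_add]
      congr 1
      ring
    simp only [Pi.add_apply, green, hw, e, Real.exp_neg |y|]
    ring
  have hg0 : ∀ y, 0 ≤ green y := fun y => by unfold green; positivity
  set K := ∫ y, green y * w y with hK
  have hK0 : 0 ≤ K := integral_nonneg fun y => mul_nonneg (hg0 y) (hw0 y)
  set A' := max A (1 / 2) with hA'
  have hA'0 : 0 ≤ A' := hA.le.trans (le_max_left _ _)
  have hrate : 0 ≤ rateConst α b κ K := by
    unfold rateConst sourceConst
    positivity
  -- `A' + 1` comes from the flow acting on the weight and on the measure, `rateConst` from the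
  -- residuals; both depend only on `φ` and the parameters.
  refine ⟨A' + 1 + rateConst α b κ K, by positivity, ?_⟩
  intro p hp s hs T hT u₀ u₀x ρ₀ u ux ρ _ _ hu₀ _ _ _ hsol
  obtain ⟨U, V, R, hU, hV, hR, hUu, hVu, hRu, hd, hae⟩ := hsol.exists_regular hs hT.le
  rw [supNorm_congr hae]
  have hfin := supNorm_lt_top T hU hV hR
  refine ⟨hfin, fun t ht => ?_⟩
  obtain ⟨au, av, ar⟩ := hae t ht
  obtain ⟨bu, -, br⟩ := hae 0 ⟨le_rfl, hT.le⟩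
  have iu : u₀ =ᵐ[volume] U 0 := hsol.init_u.symm.trans bu
  have ir : ρ₀ =ᵐ[volume] R 0 := hsol.init_rho.symm.trans br
  have iv : u₀x =ᵐ[volume] V 0 := hu₀.ae_eq iu (hd 0) (V 0).continuous
  rw [weightedSum_congr au av ar, weightedSum_congr iu iv ir]
  set M := (supNorm T (fun t => U t) (fun t => V t) (fun t => R t)).toReal with hM
  have hM0 : 0 ≤ M := ENNReal.toReal_nonneg
  have hlim := ((tendsto_eLpNorm_mul_truncWeight hpos p hφc (U t).continuous).add
    (tendsto_eLpNorm_mul_truncWeight hpos p hφc (V t).continuous)).add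
    (tendsto_eLpNorm_mul_truncWeight hpos p hφc (R t).continuous)
  -- Only the left side needs the limit: on the right the truncated initial norms are already at
  -- most the full ones.
  refine le_of_tendsto' hlim fun n => ?_
  have hn := isLogLipschitzModerate_truncWeight hpos hlip hv0 hC₀.le hmod n
  have hnp := memLp_truncWeight hpos hφc n p
  have key := weighted_sum_le_mul_exp hU hV hR hUu hVu hRu hd
    (hsol.weakTransport_velocity hU hV hR hd hae) (hsol.weakTransport_slope hU hV hR hd hae)
    (hsol.weakTransport_density hae) hM0 (fun t ht x => (abs_le_supNorm hfin ht x).1)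
    (fun t ht x => (abs_le_supNorm hfin ht x).2.1) (fun t ht x => (abs_le_supNorm hfin ht x).2.2)
    hp hA'0 hn hnp hgw hw0 ht
  have hle : wnorm p (truncWeight φ n) (U t) + wnorm p (truncWeight φ n) (V t)
      + wnorm p (truncWeight φ n) (R t) ≤ (wnorm p (truncWeight φ n) (U 0)
        + wnorm p (truncWeight φ n) (V 0) + wnorm p (truncWeight φ n) (R 0)) *
        Real.exp ((A' + 1 + rateConst α b κ K) * (1 + M) * t) := by
    refine key.trans (mul_le_mul_of_nonneg_left (Real.exp_le_exp.2 ?_)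
      (add_nonneg (add_nonneg (wnorm_nonneg _) (wnorm_nonneg _)) (wnorm_nonneg _)))
    refine mul_le_mul_of_nonneg_right ?_ ht.1
    nlinarith
  have hofReal := ENNReal.ofReal_le_ofReal hle
  rw [ENNReal.ofReal_mul' (Real.exp_pos _).le, ← weightedSum_eq_ofReal hnp,
    ← weightedSum_eq_ofReal hnp] at hofReal
  refine hofReal.trans (mul_le_mul_left ?_ _)
  exact add_le_add (add_le_add (eLpNorm_mul_truncWeight_le hpos p _ n)
    (eLpNorm_mul_truncWeight_le hpos p _ n)) (eLpNorm_mul_truncWeight_le hpos p _ n)
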